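/- Let $K$ be a field. For simple graphs $G_1$ on $[m]$ and $G_2$ on $[n]$, let $X=(x_{ij})$ be an $m\times n$ matrix of indeterminates and let $J_{G_1,G_2}\subseteq K[x_{ij}: 1\le i\le m,\ 1\le j\le n]$ be the ideal generated by the $2$-minors $x_{ik}x_{jl}-x_{il}x_{jk}$ with $\{i,j\}\in E(G_1)$ and $\{k,l\}\in E(G_2)$. An ideal $I$ of a Noetherian ring $S$ is called unmixed if all associated primes of $S/I$ have the same height. The join $G*G'$ of two graphs on disjoint vertex sets is obtained from their disjoint union $G\sqcup G'$ by adding all edges between the vertices of $G$ and those of $G'$. For a graph $G$ and a set $T$ of vertices of $G$, let $c_G(T)$ be the number of connected components of the graph $G-T$ obtained by deleting $T$. A vertex is a cut point of a graph if its deletion increases the number of connected components. Let $\mathcal C(G)$ be the collection consisting of $\emptyset$ and of all vertex sets $T$ of $G$ such that every $i\in T$ is a cut point of the subgraph of $G$ induced on $(V(G)\setminus T)\cup\{i\}$. Theorem. Let $G_1,H,H_1,\ldots,H_r$ be connected graphs on $m,t,n_1,\ldots,n_r$ vertices, respectively, where $r\ge 2$ and $2\le m\le t+\sum_{i=1}^r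 n_i$, and suppose that for each $i=1,\ldots,r$ either $n_i=1$ or $n_i\ge m$. Let $G_2:=H*(H_1\sqcup\cdots\sqcup H_r)$. Then $J_{G_1,G_2}$ is unmixed if and only if the following four conditions hold: (a) $J_{G_1,H_i}$ is unmixed for all $i=1,\ldots,r$; (b) $G_1$ is complete; (c) $t=(r-1)(m-1)$; (d) for every nonempty $T\in\mathcal C(H)$, $(c_H(T)-1)(m-1)=|T|+\sum_{i=1}^r n_i$. -/

import Mathlib

/-- An ideal is unmixed if all the associated primes of `R ⧸ I` have the same height. -/
def Ideal.IsUnmixed {R : Type*} [CommRing R] (I : Ideal R) : Prop :=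
  ∀ p ∈ associatedPrimes R (R ⧸ I), ∀ q ∈ associatedPrimes R (R ⧸ I), p.height = q.height

namespace SimpleGraph

/-- The binomial edge ideal `J_{G₁,G₂}` of a pair of graphs, in the polynomial ring over `K` in the
entries of the generic `V × W` matrix: it is generated by the 2-minors `[i, j | k, l]` with `{i, j}`
an edge of `G₁` and `{k, l}` an edge of `G₂`. (Exchanging `i, j` or `k, l` only changes the sign.) -/
noncomputable def pairBinomialEdgeIdeal (K : Type*) [Field K] {V W : Type*}
    (G₁ : SimpleGraph V) (G₂ : SimpleGraph W) : Ideal (MvPolynomial (V × W) K) :=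
  Ideal.span {f | ∃ i j k l, G₁.Adj i j ∧ G₂.Adj k l ∧
    f = MvPolynomial.X (i, k) * MvPolynomial.X (j, l)
      - MvPolynomial.X (i, l) * MvPolynomial.X (j, k)}

/-- The join `G * H` on the disjoint union of the vertex sets. -/
def joinGraph {V W : Type*} (G : SimpleGraph V) (H : SimpleGraph W) : SimpleGraph (V ⊕ W) :=
  (G ⊕g H) ⊔ completeBipartiteGraph V W

/-- The disjoint union of a family of graphs. -/
def sigmaGraph {ι : Type*} {V : ι → Type*} (H : ∀ i, SimpleGraph (V i)) :
    SimpleGraph (Σ i, V i) :=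
  ⨆ i, (H i).map (Function.Embedding.sigmaMk i)

/-- The number of connected components. -/
noncomputable def numComponents {V : Type*} (G : SimpleGraph V) : ℕ :=
  Nat.card G.ConnectedComponent

/-- `c_G(T)`: the number of connected components of `G` after the deletion of `T`. -/
noncomputable def numComponentsAfter {V : Type*} (G : SimpleGraph V) (T : Finset V) : ℕ :=
  (G.induce {v | v ∉ T}).numComponents

/-- A vertex whose deletion increases the number of connected components. -/
def IsCutPoint {V : Type*} (G : SimpleGraph V) (v : V) : Prop :=
  G.numComponents < (G.induce {w | w ≠ v}).numComponents

/-- `T` has the cut point property: every `i ∈ T` is a cut point of the subgraph of `G` induced on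
`(V \ T) ∪ {i}`. -/
def HasCutPointProperty {V : Type*} (G : SimpleGraph V) (T : Finset V) : Prop :=
  ∀ i ∈ T, (G.induce {v | v ∉ T ∨ v = i}).IsCutPoint ⟨i, Or.inr rfl⟩

/-- The collection `𝒞(G)` of the empty set and all vertex sets with the cut point property. -/
def cutPointSets {V : Type*} (G : SimpleGraph V) : Set (Finset V) :=
  {∅} ∪ {T | G.HasCutPointProperty T}

end SimpleGraph

/-! For a vertex set `T` of `G`, let `P_T` (`componentPrime`) be the kernel of the map that kills
the columns in `T` and puts a generic rank-one matrix on each component of `G - T`. Its height is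
`|T| + (m - 1)(n - c_G(T))`, where `n` is the number of columns (`height_componentPrime`): explicit
chains of primes below and above it already use up the dimension `mn`.

If `G₁` is complete, the ideal `J` of `G₁` and `G` is the intersection of all `P_T`
(`mem_pairBinomialEdgeIdeal_top`). Hence every associated prime is some `P_T`, and `T` must lie in
`𝒞(G)`, since otherwise a smaller set gives a smaller prime. Conversely, for `T ∈ 𝒞(G)` and any
connected `G₁` the prime `P_T` is minimal over `J` (`componentPrime_mem_minimalPrimes`). For
connected `G`, comparing heights with `T = ∅` shows that unmixedness implies `(c_G(T) - 1)(m - 1) =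
|T|` for all `T ∈ 𝒞(G)`, and is equivalent to it when `G₁` is complete.

Transposing the matrix exchanges the two graphs. If `G₁` is not complete, it has a cut set `S`
leaving at least two components, and the numerical condition would give `|S| ≥ n - 1`, whereas `|S|
≤ m - 2`. So `m ≤ n` forces (b).

It remains to find the cut sets of the join. A nonempty one contains all of `H` or all of the `H_i`,
because otherwise the rest is connected. The first kind is `V(H)` together with arbitrary members of
the `𝒞(H_i)`, the second is a nonempty member of `𝒞(H)` together with all `V(H_i)`. The numerical
condition on the first kind amounts to (a) and (c), on the second to (d). -/

namespace Order

/-! ### Heights from chains -/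

/-- A function on finite sets that increases strictly whenever an element of `s` is removed
yields a chain with `s.card` steps. -/
theorem height_add_card_le {α β : Type*} [DecidableEq α] [Preorder β] (F : Finset α → β)
    (s : Finset α) (h : ∀ A ⊆ s, ∀ a ∈ A, F A < F (A.erase a)) :
    height (F s) + s.card ≤ height (F ∅) := by
  induction s using Finset.induction_on with
  | empty => simp
  | insert a s ha ih =>
    have h1 := height_add_one_le (h _ subset_rfl a (Finset.mem_insert_self a s))
    rw [Finset.erase_insert ha] at h1
    have h2 := ih fun A hA b hb => h A (hA.trans (Finset.subset_insert a s)) b hb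
    rw [Finset.card_insert_of_notMem ha]
    calc height (F (insert a s)) + ((s.card + 1 : ℕ) : ℕ∞)
        = (height (F (insert a s)) + 1) + s.card := by push_cast; ring
      _ ≤ height (F s) + s.card := by gcongr
      _ ≤ _ := h2

theorem coheight_add_card_le {α β : Type*} [DecidableEq α] [Preorder β] (F : Finset α → β)
    (s : Finset α) (h : ∀ A ⊆ s, ∀ a ∈ A, F (A.erase a) < F A) :
    coheight (F s) + s.card ≤ coheight (F ∅) :=
  height_add_card_le (fun A => OrderDual.toDual (F A)) s h

theorem height_add_coheight_le_krullDim {α : Type*} [Preorder α] (a : α) :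
    ((height a + coheight a : ℕ∞) : WithBot ℕ∞) ≤ krullDim α := by
  have : Nonempty α := ⟨a⟩
  rw [krullDim_eq_iSup_height_add_coheight_of_nonempty]
  exact_mod_cast le_iSup (fun a : α => height a + coheight a) a

end Order

/-- The kernel of an algebra homomorphism to a domain, as a point of the prime spectrum. -/
def AlgHom.kerPoint {K R S : Type*} [CommRing K] [CommRing R] [CommRing S] [IsDomain S]
    [Algebra K R] [Algebra K S] (f : R →ₐ[K] S) : PrimeSpectrum R :=
  ⟨RingHom.ker f, RingHom.ker_isPrime f⟩

/-- A specialization `h` of the target enlarges the kernel, and `x` witnesses that it does so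
strictly. Every step of the chains of primes below arises in this way. -/
theorem AlgHom.kerPoint_lt {K R S S' : Type*} [CommRing K] [CommRing R] [CommRing S] [IsDomain S]
    [CommRing S'] [IsDomain S'] [Algebra K R] [Algebra K S] [Algebra K S'] {f : R →ₐ[K] S}
    {g : R →ₐ[K] S'} (h : S →ₐ[K] S') (hfg : ∀ x, h (f x) = g x) {x : R} (hf : f x ≠ 0)
    (hg : g x = 0) : f.kerPoint < g.kerPoint := by
  change RingHom.ker f < RingHom.ker g
  refine lt_of_le_of_ne (fun y hy => ?_) fun he => hf ?_
  · rw [RingHom.mem_ker] at hy ⊢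
    rw [← hfg, hy, map_zero]
  · rw [← RingHom.mem_ker, he]
    exact hg

/-! ### The height of the prime of a partial partition of the columns -/

namespace MvPolynomial

variable (K : Type*) [Field K] {V W κ : Type*}

/-- Given a partial partition `c` of the columns of a generic matrix, the map that kills the
columns outside of all blocks and replaces each block by a generic matrix of rank one. -/
noncomputable def blockMap (V : Type*) (c : W → Option κ) :
    MvPolynomial (V × W) K →ₐ[K] MvPolynomial ((V × κ) ⊕ W) K :=
  aeval fun p => (c p.2).elim 0 fun k => X (.inl (p.1, k)) * X (.inr p.2)

variable {K}

theorem blockMap_X_of_none {c : W → Option κ} {i : V} {j : W} (h : c j = none) :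
    blockMap K V c (X (i, j)) = 0 := by
  simp [blockMap, h]

theorem blockMap_X_of_some {c : W → Option κ} {i : V} {j : W} {k : κ} (h : c j = some k) :
    blockMap K V c (X (i, j)) = X (.inl (i, k)) * X (.inr j) := by
  simp [blockMap, h]

/-- The evaluation at `0` of the variables in `B`. -/
noncomputable def kill {σ : Type*} [DecidableEq σ] (B : Finset σ) :
    MvPolynomial σ K →ₐ[K] MvPolynomial σ K :=
  aeval fun q => if q ∈ B then 0 else X q

theorem kill_X {σ : Type*} [DecidableEq σ] (B : Finset σ) (q : σ) :
    kill B (X q : MvPolynomial σ K) = if q ∈ B then 0 else X q := by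
  simp [kill]

theorem kill_kill {σ : Type*} [DecidableEq σ] {A B : Finset σ} (h : A ⊆ B)
    (f : MvPolynomial σ K) : kill B (kill A f) = kill B f := by
  have : (kill B : MvPolynomial σ K →ₐ[K] _).comp (kill A) = kill B := by
    ext q
    by_cases hA : q ∈ A
    · simp [kill_X, hA, h hA]
    · simp [kill_X, hA]
  exact DFunLike.congr_fun this f

variable [Fintype V] [Fintype W] [Fintype κ] [DecidableEq V] [DecidableEq W] [DecidableEq κ]

/-- With one representative column in each block, first the scalars of the other block columns are
set to zero one by one, then the entries of the block vectors. The entries of the representative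
columns still detect the latter, as their scalars are kept. -/
theorem card_le_coheight_blockMap (c : W → Option κ) {rep : κ → W}
    (hrep : ∀ k, c (rep k) = some k) (i₀ : V) :
    ((Fintype.card V * Fintype.card κ
        + {j | c j ≠ none ∧ ∀ k, rep k ≠ j}.toFinset.card : ℕ) : ℕ∞) ≤
      Order.coheight (blockMap K V c).kerPoint := by
  set N : Finset W := {j | c j ≠ none ∧ ∀ k, rep k ≠ j}.toFinset with hN
  let F (A : Finset (V × κ)) (B : Finset W) : PrimeSpectrum (MvPolynomial (V × W) K) :=
    AlgHom.kerPoint ((kill (A.disjSum B)).comp (blockMap K V c))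
  have h1 := Order.coheight_add_card_le (fun B => F ∅ B) N (by
    intro B hB j hj
    obtain ⟨hc, -⟩ : c j ≠ none ∧ ∀ k, rep k ≠ j := by simpa [hN] using hB hj
    obtain ⟨k, hk⟩ := Option.ne_none_iff_exists'.mp hc
    refine AlgHom.kerPoint_lt (kill (Finset.disjSum ∅ B)) (x := X (i₀, j)) (fun x => ?_) ?_ ?_
    · exact kill_kill (Finset.disjSum_mono subset_rfl (Finset.erase_subset _ _)) _
    · simp [blockMap_X_of_some hk, kill_X]
    · simp [blockMap_X_of_some hk, kill_X, hj])
  have h2 := Order.coheight_add_card_le (fun A => F A N) Finset.univ (by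
    rintro A - ⟨i, k⟩ hik
    refine AlgHom.kerPoint_lt (kill (Finset.disjSum A N)) (x := X (i, rep k))
      (fun x => ?_) ?_ ?_
    · exact kill_kill (Finset.disjSum_mono (Finset.erase_subset _ _) subset_rfl) _
    · simp [blockMap_X_of_some (hrep k), kill_X, hN]
    · simp [blockMap_X_of_some (hrep k), kill_X, hik])
  have h3 : F ∅ ∅ = (blockMap K V c).kerPoint := by
    have : (kill (Finset.disjSum ∅ ∅) : MvPolynomial ((V × κ) ⊕ W) K →ₐ[K] _) = AlgHom.id _ _ := by
      ext q
      simp [kill_X]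
    simp only [F, this, AlgHom.id_comp]
  rw [h3] at h1
  refine le_trans ?_ h1
  rw [Nat.cast_add, ← Fintype.card_prod]
  gcongr
  exact le_trans le_add_self h2

/-- A deformation of `blockMap` in which the entries in `A` are perturbed by new variables. -/
noncomputable def deformedBlockMap (K : Type*) [Field K] (c : W → Option κ) (A : Finset (V × W)) :
    MvPolynomial (V × W) K →ₐ[K] MvPolynomial (((V × κ) ⊕ W) ⊕ (V × W)) K :=
  aeval fun p => ((c p.2).elim 0 fun k => X (.inl (.inl (p.1, k))) * X (.inl (.inr p.2)))
    + if p ∈ A then X (.inr p) else 0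

omit [Fintype V] [Fintype W] [Fintype κ] [DecidableEq κ] in
theorem deformedBlockMap_X (c : W → Option κ) (A : Finset (V × W)) (p : V × W) :
    deformedBlockMap K c A (X p) =
      ((c p.2).elim 0 fun k => X (.inl (.inl (p.1, k))) * X (.inl (.inr p.2)))
        + if p ∈ A then X (.inr p) else 0 := by
  simp [deformedBlockMap]

omit [Fintype V] [Fintype W] [Fintype κ] in
theorem kill_deformedBlockMap (c : W → Option κ) (A : Finset (V × W)) (p : V × W)
    (f : MvPolynomial (V × W) K) :
    kill {.inr p} (deformedBlockMap K c A f) = deformedBlockMap K c (A.erase p) f := by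
  have : (kill {.inr p}).comp (deformedBlockMap K c A) = deformedBlockMap K c (A.erase p) := by
    ext q
    by_cases hq : q = p <;> rcases hc : c q.2 with _ | k <;> by_cases hA : q ∈ A <;>
      simp_all [deformedBlockMap_X, kill_X]
  exact DFunLike.congr_fun this f

omit [Fintype V] [Fintype W] [Fintype κ] in
theorem ker_deformedBlockMap_lt (c : W → Option κ) {A : Finset (V × W)} {i : V} {j : W}
    {x : MvPolynomial (V × W) K} (hx : deformedBlockMap K c A x ≠ 0)
    (hx' : deformedBlockMap K c (A.erase (i, j)) x = 0) :
    (deformedBlockMap K c A).kerPoint <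
      (deformedBlockMap K c (A.erase (i, j))).kerPoint := by
  have h := kill_deformedBlockMap (K := K) c A (i, j)
  exact AlgHom.kerPoint_lt _ h hx hx'

/-- The perturbations are removed one at a time. They are placed on the zero columns and, away from
row `i₀`, on the block columns that are not representatives, so that row `i₀` and the
representatives of the blocks stay undisturbed. -/
theorem card_le_height_blockMap (c : W → Option κ) {rep : κ → W}
    (hrep : ∀ k, c (rep k) = some k) (i₀ : V) :
    (({p : V × W | c p.2 = none ∨ (p.1 ≠ i₀ ∧ ∀ k, rep k ≠ p.2)}.toFinset.card : ℕ) : ℕ∞) ≤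
      Order.height (blockMap K V c).kerPoint := by
  set N : Finset (V × W) := {p | c p.2 = none ∨ (p.1 ≠ i₀ ∧ ∀ k, rep k ≠ p.2)}.toFinset with hN
  have h1 := Order.height_add_card_le
    (fun A => (deformedBlockMap K c A).kerPoint) N (by
    rintro A hA ⟨i, j⟩ hij
    have hA' : ∀ p ∈ A, c p.2 = none ∨ (p.1 ≠ i₀ ∧ ∀ k, rep k ≠ p.2) := fun p hp => by
      simpa [hN] using hA hp
    rcases hc : c j with _ | k
    · refine ker_deformedBlockMap_lt c (x := X (i, j)) ?_ ?_
      · simp [deformedBlockMap_X, hc, hij]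
      · simp [deformedBlockMap_X, hc]
    · have hi : i ≠ i₀ ∧ ∀ k, rep k ≠ j := by simpa [hc] using hA' _ hij
      have h0 : (i₀, rep k) ∉ A := fun h => by simpa [hrep] using hA' _ h
      have h0' : (i₀, j) ∉ A := fun h => by simpa [hc] using hA' _ h
      have h0'' : (i, rep k) ∉ A := fun h => by
        exact ((hA' _ h).resolve_left (by simp [hrep])).2 k rfl
      refine ker_deformedBlockMap_lt c
        (x := X (i, j) * X (i₀, rep k) - X (i, rep k) * X (i₀, j)) ?_ ?_
      · have : deformedBlockMap K c A
            (X (i, j) * X (i₀, rep k) - X (i, rep k) * X (i₀, j)) =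
            X (.inr (i, j)) * (X (.inl (.inl (i₀, k))) * X (.inl (.inr (rep k)))) := by
          simp only [map_sub, map_mul, deformedBlockMap_X, hc, hrep, hij, h0, h0', h0'',
            Option.elim, if_true, if_false]
          ring
        rw [this]
        exact mul_ne_zero (X_ne_zero _) (mul_ne_zero (X_ne_zero _) (X_ne_zero _))
      · simp only [map_sub, map_mul, deformedBlockMap_X, hc, hrep, h0, h0', h0'',
            Option.elim, if_false, Finset.mem_erase, and_false, ne_eq, not_true, false_and]
        ring)
  have h2 : (deformedBlockMap K c (∅ : Finset (V × W))).kerPoint =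
      (blockMap K V c).kerPoint := by
    have : deformedBlockMap K c (∅ : Finset (V × W)) = (rename Sum.inl).comp (blockMap K V c) := by
      ext p
      rcases hc : c p.2 with _ | k
      · simp [deformedBlockMap_X, hc, blockMap]
      · simp [deformedBlockMap_X, hc, blockMap]
    ext x
    change deformedBlockMap K c ∅ x = 0 ↔ blockMap K V c x = 0
    rw [this]
    exact (map_eq_zero_iff _ (rename_injective _ Sum.inl_injective))
  rw [h2] at h1
  exact le_trans le_add_self h1

-- Here `v` counts rows, `k` blocks, `n` block columns that are not representatives, `s` all block
-- columns, `z` zero columns and `w` all columns. The two lower bounds add up to `v * w`, so they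
-- are sharp.
omit [Fintype V] [Fintype W] [Fintype κ] [DecidableEq V] [DecidableEq W] [DecidableEq κ] in
theorem eq_of_chain_bounds {a b : ℕ∞} {v k n s z w m h : ℕ} (h1 : ((v * k + n : ℕ) : ℕ∞) ≤ b)
    (h2 : ((v * z + (v - 1) * n : ℕ) : ℕ∞) ≤ a) (h3 : a + b ≤ (v * w : ℕ)) (hm : v = m + 1)
    (c1 : n + k = s) (c2 : s + z = w) (hh : h + s + (v - 1) * k = v * w) : a = h := by
  have ha : a ≠ ⊤ := fun ha => by
    rw [ha, top_add, top_le_iff] at h3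
    exact ENat.natCast_ne_top _ h3
  have hb : b ≠ ⊤ := fun hb => by
    rw [hb, add_top, top_le_iff] at h3
    exact ENat.natCast_ne_top _ h3
  lift a to ℕ using ha
  lift b to ℕ using hb
  norm_cast at h1 h2 h3 ⊢
  subst hm c1 c2
  simp only [Nat.add_sub_cancel] at *
  nlinarith

/-- The height of the prime ideal that belongs to a partition of some of the columns
into blocks. -/
theorem height_ker_blockMap [Nonempty V] (c : W → Option κ) (hc : ∀ k, ∃ j, c j = some k) {h : ℕ}
    (hh : h + {j | c j ≠ none}.toFinset.card + (Fintype.card V - 1) * Fintype.card κ =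
      Fintype.card V * Fintype.card W) :
    (RingHom.ker (blockMap K V c)).height = h := by
  choose rep hrep using hc
  let i₀ : V := Classical.arbitrary V
  have h1 := card_le_coheight_blockMap (K := K) c hrep i₀
  have h2 := card_le_height_blockMap (K := K) c hrep i₀
  have h3 := Order.height_add_coheight_le_krullDim (blockMap K V c).kerPoint
  have h4 : (blockMap K V c).kerPoint.asIdeal.height = _ := PrimeSpectrum.height_eq_orderHeight _
  have h5 : Order.krullDim (PrimeSpectrum (MvPolynomial (V × W) K)) =
      ((Fintype.card V * Fintype.card W : ℕ) : ℕ∞) := by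
    change ringKrullDim _ = _
    rw [ringKrullDim_of_isNoetherianRing, ringKrullDim_eq_zero_of_field]
    simp
  rw [h5, WithBot.coe_le_coe] at h3
  have hinj : Function.Injective rep := fun k k' hk => by
    simpa [hrep, hrep] using congrArg c hk
  have c1 : {j | c j ≠ none ∧ ∀ k, rep k ≠ j}.toFinset.card + Fintype.card κ =
      {j | c j ≠ none}.toFinset.card := by
    rw [← Finset.card_univ, ← Finset.card_map ⟨rep, hinj⟩, ← Finset.card_union_of_disjoint]
    · congr 1
      ext j
      by_cases hj : ∃ k, rep k = j
      · obtain ⟨k, rfl⟩ := hj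
        simp [hrep]
      · have : ∀ k, rep k ≠ j := by simpa using hj
        simp [this]
    · rw [Finset.disjoint_left]
      intro j
      simp
  have c2 : {j | c j ≠ none}.toFinset.card + {j | c j = none}.toFinset.card = Fintype.card W := by
    rw [← Finset.card_univ, ← Finset.card_union_of_disjoint]
    · congr 1
      ext j
      simp [em']
    · rw [Finset.disjoint_left]
      intro j
      simp
  have c3 : {p : V × W | c p.2 = none ∨ (p.1 ≠ i₀ ∧ ∀ k, rep k ≠ p.2)}.toFinset.card =
      Fintype.card V * {j | c j = none}.toFinset.card +
      (Fintype.card V - 1) * {j | c j ≠ none ∧ ∀ k, rep k ≠ j}.toFinset.card := by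
    rw [← Finset.card_univ, ← Finset.card_erase_of_mem (Finset.mem_univ i₀), ← Finset.card_product,
      ← Finset.card_product, ← Finset.card_union_of_disjoint]
    · congr 1
      ext ⟨i, j⟩
      by_cases hj : c j = none
      · simp [hj]
      · simp [hj]
    · rw [Finset.disjoint_left]
      rintro ⟨i, j⟩
      simp +contextual
  rw [c3] at h2
  obtain ⟨m, hm⟩ : ∃ m, Fintype.card V = m + 1 :=
    Nat.exists_eq_succ_of_ne_zero (Fintype.card_ne_zero (α := V))
  exact h4.trans <| eq_of_chain_bounds h1 h2 h3 hm c1 c2 hh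

end MvPolynomial

/-! ### Monomials with equal image, connected by swaps -/

namespace MvPolynomial

variable {K : Type*} [Field K] {V W κ : Type*}

/-- The exponent of the image of the variable `p` under `blockMap`, the entry for the block being
left out in the columns outside of all blocks. -/
noncomputable def blockExponent (c : W → Option κ) (p : V × W) : (V × κ) ⊕ W →₀ ℕ :=
  (c p.2).elim 0 (fun k => Finsupp.single (.inl (p.1, k)) 1) + Finsupp.single (.inr p.2) 1

/-- The additive extension of `blockExponent` to all exponents. -/
noncomputable def blockDegree (c : W → Option κ) :
    (V × W →₀ ℕ) →ₗ[ℕ] ((V × κ) ⊕ W →₀ ℕ) :=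
  Finsupp.linearCombination ℕ (blockExponent c)

theorem blockDegree_single (c : W → Option κ) (p : V × W) :
    blockDegree c (Finsupp.single p 1) = blockExponent c p := by
  simp [blockDegree]

theorem blockDegree_apply_ne_zero {c : W → Option κ} {v : V × W →₀ ℕ} {q : (V × κ) ⊕ W} :
    blockDegree c v q ≠ 0 ↔ ∃ p, v p ≠ 0 ∧ blockExponent c p q ≠ 0 := by
  simp [blockDegree, Finsupp.linearCombination_apply, Finsupp.sum, Finsupp.finsetSum_apply]

theorem blockDegree_inl_ne_zero {c : W → Option κ} {v : V × W →₀ ℕ} {i : V} {k : κ} :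
    blockDegree c v (.inl (i, k)) ≠ 0 ↔ ∃ j, v (i, j) ≠ 0 ∧ c j = some k := by
  classical
  rw [blockDegree_apply_ne_zero]
  constructor
  · rintro ⟨⟨i', j⟩, hv, h⟩
    rcases hc : c j with _ | k'
    · simp [blockExponent, hc] at h
    · simp only [blockExponent, hc, Option.elim, Finsupp.add_apply, Finsupp.single_apply] at h
      simp at h
      obtain ⟨rfl, rfl⟩ := h
      exact ⟨j, hv, hc⟩
  · rintro ⟨j, hv, hc⟩
    exact ⟨(i, j), hv, by simp [blockExponent, hc]⟩

theorem blockDegree_inr_ne_zero {c : W → Option κ} {v : V × W →₀ ℕ} {j : W} :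
    blockDegree c v (.inr j) ≠ 0 ↔ ∃ i, v (i, j) ≠ 0 := by
  classical
  rw [blockDegree_apply_ne_zero]
  constructor
  · rintro ⟨⟨i, j'⟩, hv, h⟩
    have : j' = j := by
      rcases hc : c j' with _ | k' <;>
      simpa [blockExponent, hc, Finsupp.single_apply] using h
    exact ⟨i, this ▸ hv⟩
  · rintro ⟨i, hv⟩
    exact ⟨(i, j), hv, by simp [blockExponent]⟩

theorem blockMap_monomial (c : W → Option κ) (v : V × W →₀ ℕ) (a : K)
    [Decidable (∀ p ∈ v.support, c p.2 ≠ none)] :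
    blockMap K V c (monomial v a) =
      if ∀ p ∈ v.support, c p.2 ≠ none then monomial (blockDegree c v) a else 0 := by
  rw [blockMap, aeval_monomial]
  split_ifs with h
  · have : (v.prod fun p n => ((c p.2).elim 0 fun k => X (.inl (p.1, k)) * X (.inr p.2) :
        MvPolynomial ((V × κ) ⊕ W) K) ^ n) = monomial (blockDegree c v) 1 := by
      rw [blockDegree, Finsupp.linearCombination_apply, Finsupp.sum, monomial_sum_one]
      refine Finset.prod_congr rfl fun p hp => ?_
      obtain ⟨k, hk⟩ := Option.ne_none_iff_exists'.mp (h p hp)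
      simp [hk, blockExponent, X, monomial_mul, monomial_pow]
    rw [this, algebraMap_eq, C_mul_monomial, mul_one]
  · push Not at h
    obtain ⟨p, hp, hc⟩ := h
    rw [Finsupp.prod, Finset.prod_eq_zero hp, mul_zero]
    simp [hc, Finsupp.mem_support_iff.mp hp]

theorem _root_.Finsupp.exists_eq_add_single {α : Type*} {u : α →₀ ℕ} {p : α} (h : u p ≠ 0) :
    ∃ u', u = u' + Finsupp.single p 1 :=
  ⟨u - .single p 1, (tsub_add_cancel_of_le (by simpa [Nat.one_le_iff_ne_zero])).symm⟩

/-- The ideal `I` contains the differences of monomials that arise by swapping two tokens in the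
same block, provided that all blocks are fully covered. -/
def SwapsIn (I : Ideal (MvPolynomial (V × W) K)) (c : W → Option κ) : Prop :=
  ∀ (w : V × W →₀ ℕ) (i i' : V) (j j' : W), c j = c j' → c j ≠ none →
    (∀ l, c l ≠ none →
      ∃ a, (w + .single (i, j) 1 + .single (i', j') 1) (a, l) ≠ 0) →
    monomial (w + Finsupp.single (i, j) 1 + Finsupp.single (i', j') 1) 1
      - monomial (w + Finsupp.single (i', j) 1 + Finsupp.single (i, j') 1) 1 ∈ I

theorem blockExponent_swap {c : W → Option κ} {j j' : W} (h : c j = c j') (i i' : V) :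
    blockExponent c (i, j) + blockExponent c (i', j') =
      blockExponent c (i', j) + blockExponent c (i, j') := by
  simp only [blockExponent, h]
  abel

/-- A monomial is read as a collection of tokens `(row, column)`; `blockDegree` counts tokens per
row and block, and tokens per column. The context `w` holds the tokens already matched. It keeps the
hypothesis that all block columns are occupied valid during the induction. -/
theorem SwapsIn.monomial_sub_mem {I : Ideal (MvPolynomial (V × W) K)} {c : W → Option κ}
    (hI : SwapsIn I c) (n : ℕ) : ∀ u v w : V × W →₀ ℕ, u.degree = n →
    blockDegree c u = blockDegree c v → (∀ p, u p ≠ 0 → c p.2 ≠ none) →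
    (∀ l, c l ≠ none → ∃ a, (w + u) (a, l) ≠ 0) →
    monomial (w + u) 1 - monomial (w + v) 1 ∈ I := by
  classical
  induction n with
  | zero =>
    intro u v w hu huv _ _
    obtain rfl : u = 0 := Finsupp.degree_eq_zero_iff u |>.mp hu
    obtain rfl : v = 0 := by
      ext ⟨i, j⟩
      by_contra hv
      refine blockDegree_inr_ne_zero.mpr ⟨i, hv⟩ (?_ : blockDegree c v (.inr j) = 0)
      rw [← huv]
      simp
    simp
  | succ n ih =>
    intro u v w hu huv hc hw
    obtain ⟨⟨i, j⟩, hij⟩ : ∃ p, u p ≠ 0 := by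
      by_contra! h
      obtain rfl : u = 0 := Finsupp.ext h
      simp at hu
    obtain ⟨k, hk⟩ := Option.ne_none_iff_exists'.mp (hc _ hij)
    have key : ∀ v', blockDegree c u = blockDegree c (v' + Finsupp.single (i, j) 1) →
        monomial (w + u) 1 - monomial (w + (v' + Finsupp.single (i, j) 1)) 1 ∈ I := by
      intro v' huv'
      obtain ⟨u', rfl⟩ : ∃ u', u = u' + Finsupp.single (i, j) 1 := Finsupp.exists_eq_add_single hij
      have hcomm : ∀ x : V × W →₀ ℕ,
          w + (x + Finsupp.single (i, j) 1) = w + Finsupp.single (i, j) 1 + x := fun x => by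
        rw [add_comm x, add_assoc]
      have hu' : u'.degree = n := by
        rw [map_add, Finsupp.degree_single] at hu
        exact Nat.succ.inj hu
      have huv'' : blockDegree c u' = blockDegree c v' := by
        rw [map_add, map_add] at huv'
        exact add_right_cancel huv'
      have hc' : ∀ p, u' p ≠ 0 → c p.2 ≠ none := fun p hp => hc p (by
        rw [Finsupp.add_apply]
        exact fun h => hp (Nat.eq_zero_of_add_eq_zero_right h))
      rw [hcomm] at hw
      rw [hcomm, hcomm]
      have := ih u' v' (w + Finsupp.single (i, j) 1) hu' huv'' hc' hw
      exact this
    obtain ⟨j', hj', hcj'⟩ := blockDegree_inl_ne_zero.mp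
      (by rw [← huv]; exact blockDegree_inl_ne_zero.mpr ⟨j, hij, hk⟩)
    obtain ⟨i', hi'⟩ := blockDegree_inr_ne_zero.mp
      (by rw [← huv]; exact blockDegree_inr_ne_zero.mpr ⟨i, hij⟩)
    -- If `v` lacks the token `(i, j)`, equality of degrees still provides tokens `(i, j')` and
    -- `(i', j)` with `j'` in the block of `j`. One swap of these creates `(i, j)`, which can then
    -- be moved to the context.
    by_cases hv : v (i, j) = 0
    · obtain ⟨v₀, rfl⟩ : ∃ v₀, v = v₀ + Finsupp.single (i, j') 1 + Finsupp.single (i', j) 1 := by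
        have hne : (i, j') ≠ (i', j) := by
          rintro h
          obtain ⟨rfl, rfl⟩ := Prod.mk.inj h
          exact hj' hv
        obtain ⟨v₁, rfl⟩ := Finsupp.exists_eq_add_single hi'
        have : v₁ (i, j') ≠ 0 := by
          rwa [Finsupp.add_apply, Finsupp.single_eq_of_ne hne, add_zero] at hj'
        obtain ⟨v₀, rfl⟩ := Finsupp.exists_eq_add_single this
        exact ⟨v₀, rfl⟩
      have hsw := hI (w + v₀) i i' j' j (hcj'.trans hk.symm) (by simp [hcj']) (by
        intro l hl
        obtain ⟨a, ha⟩ := hw l hl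
        have := blockDegree_inr_ne_zero (c := c).mpr ⟨a, ha⟩
        rw [map_add, huv, ← map_add, ← add_assoc, ← add_assoc] at this
        exact blockDegree_inr_ne_zero.mp this)
      have hsw' : blockDegree c (v₀ + Finsupp.single (i, j') 1 + Finsupp.single (i', j) 1) =
          blockDegree c (v₀ + Finsupp.single (i', j') 1 + Finsupp.single (i, j) 1) := by
        simp only [map_add, blockDegree_single, add_assoc]
        rw [blockExponent_swap (hcj'.trans hk.symm)]
      have h := key (v₀ + Finsupp.single (i', j') 1) (huv.trans hsw')
      rw [← add_assoc w, ← add_assoc w] at h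
      have := sub_mem h hsw
      rw [sub_sub_sub_cancel_right] at this
      rwa [← add_assoc w, ← add_assoc w]
    · obtain ⟨v', rfl⟩ : ∃ v', v = v' + Finsupp.single (i, j) 1 := Finsupp.exists_eq_add_single hv
      exact key v' huv

end MvPolynomial

/-! ### The binomial edge ideal as an intersection of component primes -/

namespace SimpleGraph

open MvPolynomial

variable {K : Type*} [Field K] {V W : Type*}

open Classical in
/-- The component of a vertex after the deletion of `T`, if the vertex is not deleted itself. -/
noncomputable def componentAfter (G : SimpleGraph W) (T : Finset W) (j : W) :
    Option (G.induce {v | v ∉ T}).ConnectedComponent :=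
  if h : j ∉ T then some ((G.induce {v | v ∉ T}).connectedComponentMk ⟨j, h⟩) else none

theorem componentAfter_eq_none {G : SimpleGraph W} {T : Finset W} {j : W} :
    G.componentAfter T j = none ↔ j ∈ T := by
  simp [componentAfter]

theorem componentAfter_of_notMem {G : SimpleGraph W} {T : Finset W} {j : W} (h : j ∉ T) :
    G.componentAfter T j = some ((G.induce {v | v ∉ T}).connectedComponentMk ⟨j, h⟩) := by
  simp [componentAfter, h]

theorem componentAfter_eq_iff {G : SimpleGraph W} {T : Finset W} {j l : W} (hj : j ∉ T)
    (hl : l ∉ T) : G.componentAfter T j = G.componentAfter T l ↔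
      (G.induce {v | v ∉ T}).Reachable ⟨j, hj⟩ ⟨l, hl⟩ := by
  simp [componentAfter, hj, hl]

/-- The prime ideal of `m × n`-matrices whose columns in `T` are zero and which have rank one on
each component of `G - T`. -/
noncomputable def componentPrime (K : Type*) [Field K] (V : Type*) (G : SimpleGraph W)
    (T : Finset W) : Ideal (MvPolynomial (V × W) K) :=
  RingHom.ker (blockMap K V (G.componentAfter T))

instance (G : SimpleGraph W) (T : Finset W) : (componentPrime K V G T).IsPrime :=
  RingHom.ker_isPrime _

theorem pairBinomialEdgeIdeal_le_componentPrime (G₁ : SimpleGraph V) (G : SimpleGraph W)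
    (T : Finset W) : pairBinomialEdgeIdeal K G₁ G ≤ componentPrime K V G T := by
  rw [pairBinomialEdgeIdeal, Ideal.span_le]
  rintro _ ⟨i, j, k, l, -, hkl, rfl⟩
  simp only [componentPrime, SetLike.mem_coe, RingHom.mem_ker, map_sub, map_mul]
  by_cases hk : k ∈ T
  · simp [blockMap_X_of_none (componentAfter_eq_none.mpr hk)]
  by_cases hl : l ∈ T
  · simp [blockMap_X_of_none (componentAfter_eq_none.mpr hl)]
  · have h : G.componentAfter T l = _ := ((componentAfter_eq_iff hk hl).mpr
      (Adj.reachable (by simpa using hkl))).symm.trans (componentAfter_of_notMem hk)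
    rw [blockMap_X_of_some h, blockMap_X_of_some h,
      blockMap_X_of_some (componentAfter_of_notMem hk),
      blockMap_X_of_some (componentAfter_of_notMem hk)]
    ring

theorem adj_swap_mem (G : SimpleGraph W) {j l : W} (h : G.Adj j l) (w : V × W →₀ ℕ) (i i' : V) :
    monomial (w + Finsupp.single (i, j) 1 + Finsupp.single (i', l) 1) 1
      - monomial (w + Finsupp.single (i', j) 1 + Finsupp.single (i, l) 1) 1 ∈
      pairBinomialEdgeIdeal K (⊤ : SimpleGraph V) G := by
  by_cases hi : i = i'
  · simp [hi]
  · have : monomial w (1 : K) * (X (i, j) * X (i', l) - X (i, l) * X (i', j)) ∈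
        pairBinomialEdgeIdeal K (⊤ : SimpleGraph V) G :=
      Ideal.mul_mem_left _ _ (Ideal.subset_span ⟨i, i', j, l, hi, h, rfl⟩)
    convert this using 1
    simp only [X, mul_sub, monomial_mul, mul_one, add_assoc]
    rw [add_comm (Finsupp.single (i', j) 1)]

/-- Swaps along edges are multiples of generators; a swap between distant columns is transported
along a path in `G - T`. This needs a token in each intermediate column, hence the covering
hypothesis in `SwapsIn`. -/
theorem swapsIn_pairBinomialEdgeIdeal (G : SimpleGraph W) (T : Finset W) :
    SwapsIn (pairBinomialEdgeIdeal K (⊤ : SimpleGraph V) G) (G.componentAfter T) := by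
  intro w i i' j j' hjj' hj hw
  have hjT : j ∉ T := mt componentAfter_eq_none.mpr hj
  have hjT' : j' ∉ T := mt componentAfter_eq_none.mpr (hjj' ▸ hj)
  have hr := (componentAfter_eq_iff hjT hjT').mp hjj'
  rw [reachable_iff_reflTransGen] at hr
  suffices H : ∀ x : {v | v ∉ T}, Relation.ReflTransGen (G.induce {v | v ∉ T}).Adj ⟨j, hjT⟩ x →
      ∀ w : V × W →₀ ℕ, ∀ i i' : V, (∀ l, l ∉ T →
        ∃ a, (w + .single (i, j) 1 + .single (i', x.1) 1) (a, l) ≠ 0) →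
      monomial (w + Finsupp.single (i, j) 1 + Finsupp.single (i', x.1) 1) 1
      - monomial (w + Finsupp.single (i', j) 1 + Finsupp.single (i, x.1) 1) 1 ∈
      pairBinomialEdgeIdeal K (⊤ : SimpleGraph V) G from
    H _ hr w i i' fun l hl => hw l (mt componentAfter_eq_none.mp hl)
  classical
  intro x hx
  induction hx with
  | refl =>
    intro w i i' _
    simp [add_assoc, add_comm (Finsupp.single (i, j) 1)]
  | @tail k l _ hkl ih =>
    intro w i i' hw
    have hkl' : G.Adj k.1 l.1 := by simpa using hkl
    by_cases hk : k.1 = j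
    · exact adj_swap_mem G (hk ▸ hkl') w i i'
    -- A token `(a, k)` serves as a helper. Exchange it with the token in column `l`, swap between
    -- `j` and `k` by induction, and exchange along `k l` again to bring `a` back to column `k`.
    obtain ⟨a, ha⟩ := hw k.1 k.2
    have ha' : w (a, k.1) ≠ 0 := by
      have h1 : l.1 ≠ k.1 := hkl'.ne'
      simpa [Finsupp.single_apply, Ne.symm hk, h1] using ha
    obtain ⟨w, rfl⟩ : ∃ w', w = w' + Finsupp.single (a, k.1) 1 := Finsupp.exists_eq_add_single ha'
    have h1 := adj_swap_mem (K := K) G hkl' (w + Finsupp.single (i, j) 1) a i'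
    have h2 := ih (w + Finsupp.single (a, l.1) 1) i i' (by
      intro b hb
      obtain ⟨d, hd⟩ := hw b hb
      by_cases hbl : b = l.1
      · exact ⟨a, by simp [hbl]⟩
      by_cases hbk : b = k.1
      · exact ⟨i', by simp [hbk]⟩
      refine ⟨d, ?_⟩
      simpa [Finsupp.single_apply, Ne.symm hbl, Ne.symm hbk] using hd)
    have h3 := adj_swap_mem (K := K) G hkl' (w + Finsupp.single (i', j) 1) i a
    have hcomm : ∀ x y z : V × W →₀ ℕ, w + x + y + z = w + z + x + y := fun x y z => by abel
    rw [hcomm _ (Finsupp.single (i', k.1) 1), add_right_comm w] at h1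
    rw [hcomm (Finsupp.single (i', j) 1) (Finsupp.single (i, k.1) 1),
      add_right_comm w (Finsupp.single (i', j) 1)] at h3
    have := add_mem (add_mem h1 h2) h3
    rwa [sub_add_sub_cancel, sub_add_sub_cancel] at this

/-- The generalized binomial edge ideal is the intersection of the ideals `componentPrime`. -/
theorem mem_pairBinomialEdgeIdeal_top [Finite V] [Finite W] (G : SimpleGraph W)
    {f : MvPolynomial (V × W) K} (hf : ∀ T, f ∈ componentPrime K V G T) :
    f ∈ pairBinomialEdgeIdeal K (⊤ : SimpleGraph V) G := by
  classical
  have := Fintype.ofFinite W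
  induction hn : f.support.card using Nat.strong_induction_on generalizing f with
  | _ n ih =>
  by_cases h0 : f = 0
  · simp [h0]
  obtain ⟨u, hu⟩ : f.support.Nonempty := by simpa [Finset.nonempty_iff_ne_empty] using h0
  -- `T` consists of the columns missing from `u`, so that `u` survives in the parametrization and
  -- occupies every other column, as the swaps require.
  set T : Finset W := Finset.univ.filter fun j => ∀ i, u (i, j) = 0 with hT
  set c := G.componentAfter T with hc
  have hcov : ∀ l, c l ≠ none → ∃ a, u (a, l) ≠ 0 := fun l hl => by
    have : l ∉ T := mt componentAfter_eq_none.mpr hl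
    simpa [hT] using this
  have huc : ∀ p, u p ≠ 0 → c p.2 ≠ none := fun p hp h => hp <| by
    have := componentAfter_eq_none.mp h
    simp only [hT, Finset.mem_filter] at this
    exact this.2 p.1
  -- As `f` lies in the prime of `T`, the image of the term at `u` must cancel against another term
  -- of `f`.
  obtain ⟨v, hv, hvu, hE⟩ : ∃ v ∈ f.support, v ≠ u ∧ blockDegree c v = blockDegree c u := by
    by_contra! hno
    have h1 : coeff (blockDegree c u) (blockMap K V c f) = 0 := by
      rw [RingHom.mem_ker.mp (hf T), coeff_zero]
    conv at h1 => enter [1, 2, 2]; rw [f.as_sum]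
    rw [map_sum, coeff_sum, Finset.sum_eq_single_of_mem u hu, blockMap_monomial,
      if_pos fun p hp => huc p (Finsupp.mem_support_iff.mp hp), coeff_monomial, if_pos rfl] at h1
    · exact mem_support_iff.mp hu h1
    · intro v hv hvu
      rw [blockMap_monomial]
      split_ifs
      · rw [coeff_monomial, if_neg (hno v hv hvu)]
      · simp
  have hmem : monomial u 1 - monomial v 1 ∈ pairBinomialEdgeIdeal K (⊤ : SimpleGraph V) G := by
    simpa using (swapsIn_pairBinomialEdgeIdeal (K := K) (V := V) G T).monomial_sub_mem _ u v 0 rfl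
      hE.symm huc (by simpa using hcov)
  have hmem' := Ideal.mul_mem_left _ (C (coeff u f)) hmem
  -- Subtracting this multiple removes `u` and only changes the coefficient at `v`, which is in the
  -- support already; hence the support shrinks.
  have hg := ih (f - C (coeff u f) * (monomial u 1 - monomial v 1)).support.card (by
    rw [← hn]
    refine Finset.card_lt_card (Finset.ssubset_iff_of_subset ?_ |>.mpr ⟨u, hu, ?_⟩)
    · intro x hx
      by_contra hxf
      have hxu : u ≠ x := fun h => hxf (h ▸ hu)
      have hxv : v ≠ x := fun h => hxf (h ▸ hv)
      simp [coeff_monomial, hxu, hxv, notMem_support_iff.mp hxf] at hx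
    · simp [coeff_monomial, hvu])
    (fun T => sub_mem (hf T) (pairBinomialEdgeIdeal_le_componentPrime _ _ _ hmem')) rfl
  simpa using add_mem hg hmem'


/-! ### Cut sets in terms of components -/

theorem numComponents_congr {V W : Type*} {G : SimpleGraph V} {G' : SimpleGraph W} (e : G ≃g G') :
    G.numComponents = G'.numComponents :=
  Nat.card_congr e.connectedComponentEquiv

theorem Connected.numComponents_eq_one {V : Type*} {G : SimpleGraph V} (h : G.Connected) :
    G.numComponents = 1 := by
  have := h.nonempty
  have := h.preconnected.subsingleton_connectedComponent
  exact Nat.card_of_subsingleton (G.connectedComponentMk (Classical.arbitrary V))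

theorem numComponentsAfter_empty (G : SimpleGraph W) :
    G.numComponentsAfter ∅ = G.numComponents := by
  rw [numComponentsAfter]
  have : {v : W | v ∉ (∅ : Finset W)} = Set.univ := by ext; simp
  rw [this]
  exact numComponents_congr (induceUnivIso G)

/-- Deleting the vertex `i` after restricting to the complement of `T` together with `i` amounts to
deleting `T`. -/
def induceInduceIso (G : SimpleGraph W) {T : Finset W} {i : W} (hi : i ∈ T) :
    (G.induce {v | v ∉ T ∨ v = i}).induce {w | w ≠ ⟨i, Or.inr rfl⟩} ≃g G.induce {v | v ∉ T} where
  toFun x := ⟨x.1.1, x.1.2.resolve_right fun h => x.2 (Subtype.ext h)⟩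
  invFun x := ⟨⟨x.1, Or.inl x.2⟩, fun h => x.2 (by rw [congrArg Subtype.val h]; exact hi)⟩
  left_inv _ := rfl
  right_inv _ := rfl
  map_rel_iff' := Iff.rfl

/-- If all neighbours of `i` lie in the same component of `G - T`, then putting back `i` does not
connect different components. -/
theorem componentAfter_eq_of_reachable {G : SimpleGraph W} {T : Finset W} {i : W} (hi : i ∈ T)
    (h : ∀ a b, a ∉ T → b ∉ T → G.Adj i a → G.Adj i b →
      G.componentAfter T a = G.componentAfter T b)
    {x y : {v | v ∉ T ∨ v = i}} (hx : x.1 ∉ T) (hy : y.1 ∉ T)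
    (hxy : (G.induce {v | v ∉ T ∨ v = i}).Reachable x y) :
    G.componentAfter T x = G.componentAfter T y := by
  classical
  obtain ⟨d, hd⟩ : ∃ d, ∀ a, a ∉ T → G.Adj i a → G.componentAfter T a = d := by
    by_cases hn : ∃ a, a ∉ T ∧ G.Adj i a
    · obtain ⟨a, ha, hia⟩ := hn
      exact ⟨_, fun b hb hib => h b a hb ha hib hia⟩
    · exact ⟨none, fun a ha hia => (hn ⟨a, ha, hia⟩).elim⟩
  let g (z : W) := if z = i then d else G.componentAfter T z
  have hg : ∀ z ∉ T, g z = G.componentAfter T z := fun z hz => if_neg fun h => hz (by rwa [h])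
  have hgi : g i = d := if_pos rfl
  rw [← hg _ hx, ← hg _ hy]
  rw [reachable_iff_reflTransGen] at hxy
  clear hy
  induction hxy with
  | refl => rfl
  | @tail z w _ hzw ih =>
    rw [ih]
    have hadj : G.Adj z.1 w.1 := hzw
    rcases z.2 with hz | hz <;> rcases w.2 with hw | hw
    · rw [hg _ hz, hg _ hw, componentAfter_eq_iff hz hw]
      exact Adj.reachable hadj
    · rw [hw, hgi, hg _ hz]
      rw [hw] at hadj
      exact hd _ hz hadj.symm
    · rw [hz, hgi, hg _ hw]
      rw [hz] at hadj
      exact (hd _ hw hadj).symm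
    · rw [hz, hw]

/-- Putting back `i` merges exactly the components of `G - T` that contain neighbours of `i`. The
number of components goes down just when there are at least two of these. -/
theorem isCutPoint_induce_iff [Finite W] {G : SimpleGraph W} {T : Finset W} {i : W} (hi : i ∈ T) :
    (G.induce {v | v ∉ T ∨ v = i}).IsCutPoint ⟨i, Or.inr rfl⟩ ↔
      ∃ a b, a ∉ T ∧ b ∉ T ∧ G.Adj i a ∧ G.Adj i b ∧
        G.componentAfter T a ≠ G.componentAfter T b := by
  have hle : {v | v ∉ T} ⊆ {v | v ∉ T ∨ v = i} := fun v hv => Or.inl hv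
  let f : (G.induce {v | v ∉ T}).ConnectedComponent →
      (G.induce {v | v ∉ T ∨ v = i}).ConnectedComponent :=
    ConnectedComponent.map (induceHomOfLE G hle).toHom
  rw [IsCutPoint, numComponents_congr (induceInduceIso G hi), numComponents, numComponents]
  constructor
  · intro hlt
    by_contra! hno
    refine hlt.not_ge (Nat.card_le_card_of_injective f ?_)
    intro x y
    refine ConnectedComponent.ind₂ (fun x y hxy => ?_) x y
    have h := componentAfter_eq_of_reachable hi hno (x := ⟨x.1, hle x.2⟩) (y := ⟨y.1, hle y.2⟩)
      x.2 y.2 (ConnectedComponent.exact hxy)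
    exact ConnectedComponent.sound ((componentAfter_eq_iff x.2 y.2).mp h)
  · rintro ⟨a, b, ha, hb, hia, hib, hab⟩
    have hfa : ∀ a (ha : a ∉ T), G.Adj i a →
        f (connectedComponentMk _ ⟨a, ha⟩) = connectedComponentMk _ ⟨i, Or.inr rfl⟩ :=
      fun a ha hia => ConnectedComponent.sound (Adj.reachable hia.symm)
    have := Fintype.ofFinite (G.induce {v | v ∉ T}).ConnectedComponent
    have := Fintype.ofFinite (G.induce {v | v ∉ T ∨ v = i}).ConnectedComponent
    rw [Nat.card_eq_fintype_card, Nat.card_eq_fintype_card]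
    refine Fintype.card_lt_of_surjective_not_injective f ?_ ?_
    · refine ConnectedComponent.ind ?_
      rintro ⟨v, hv | rfl⟩
      · exact ⟨connectedComponentMk _ ⟨v, hv⟩, rfl⟩
      · exact ⟨_, hfa a ha hia⟩
    · intro hinj
      refine hab ((componentAfter_eq_iff ha hb).mpr (ConnectedComponent.exact (hinj ?_)))
      rw [hfa a ha hia, hfa b hb hib]

theorem mem_cutPointSets_iff [Finite W] {G : SimpleGraph W} {T : Finset W} :
    T ∈ G.cutPointSets ↔ ∀ i ∈ T, ∃ a b, a ∉ T ∧ b ∉ T ∧ G.Adj i a ∧ G.Adj i b ∧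
      G.componentAfter T a ≠ G.componentAfter T b := by
  have : T ∈ G.cutPointSets ↔ G.HasCutPointProperty T := by
    refine ⟨?_, Or.inr⟩
    rintro (rfl | h)
    · simp [HasCutPointProperty]
    · exact h
  rw [this]
  exact forall₂_congr fun i hi => isCutPoint_induce_iff hi

theorem empty_mem_cutPointSets (G : SimpleGraph W) : ∅ ∈ G.cutPointSets :=
  Or.inl rfl

theorem numComponentsAfter_add_card_le [Fintype W] (G : SimpleGraph W) (T : Finset W) :
    G.numComponentsAfter T + T.card ≤ Fintype.card W := by
  classical
  have h : G.numComponentsAfter T ≤ Nat.card {v | v ∉ T} :=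
    Nat.card_le_card_of_surjective (connectedComponentMk _) Quot.mk_surjective
  have h2 : Nat.card {v | v ∉ T} = Tᶜ.card := by
    rw [Nat.card_eq_card_toFinset]
    congr 1
    ext
    simp
  have := Finset.card_compl_add_card T
  omega

/-- A graph that is not complete has a cut set with disconnected complement. -/
theorem exists_cutPointSet_of_ne_top [Fintype W] {G : SimpleGraph W} (h : G ≠ ⊤) :
    ∃ S ∈ G.cutPointSets, 2 ≤ G.numComponentsAfter S := by
  classical
  obtain ⟨u, v, huv, hadj⟩ : ∃ u v, u ≠ v ∧ ¬ G.Adj u v := by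
    by_contra! hno
    exact h (eq_top_iff.mpr fun a b hab => hno a b hab)
  have hex : ∃ n, ∃ S : Finset W, S.card = n ∧ 2 ≤ G.numComponentsAfter S := by
    -- Deleting everything but two nonadjacent vertices leaves two components.
    refine ⟨_, {u, v}ᶜ, rfl, ?_⟩
    have hu : u ∉ ({u, v}ᶜ : Finset W) := by simp
    have hv : v ∉ ({u, v}ᶜ : Finset W) := by simp
    refine Finite.one_lt_card_iff_nontrivial.mpr
      ⟨connectedComponentMk _ ⟨u, hu⟩, connectedComponentMk _ ⟨v, hv⟩, fun he => ?_⟩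
    have hr := ConnectedComponent.exact he
    rw [reachable_iff_reflTransGen] at hr
    suffices H : ∀ x,
        Relation.ReflTransGen (G.induce {w | w ∉ ({u, v}ᶜ : Finset W)}).Adj ⟨u, hu⟩ x →
        x.1 = u from huv (H _ hr).symm
    intro x hx
    induction hx with
    | refl => rfl
    | @tail z w _ hzw ih =>
      have hzw' : G.Adj z.1 w.1 := hzw
      have hw : w.1 = u ∨ w.1 = v := by simpa [or_iff_not_imp_left, -Subtype.coe_prop] using w.2
      rw [ih] at hzw'
      refine hw.resolve_right fun h => hadj ?_
      rwa [h] at hzw'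
  obtain ⟨S, hcard, hS⟩ := Nat.find_spec hex
  -- `S` has minimal size among the sets leaving at least two components, so putting back any `i ∈
  -- S` leaves at most one.
  refine ⟨S, Or.inr fun i hi => ?_, hS⟩
  have h1 : ¬ 2 ≤ G.numComponentsAfter (S.erase i) := fun h2 =>
    Nat.find_min hex (by rw [← hcard]; exact Finset.card_erase_lt_of_mem hi) ⟨_, rfl, h2⟩
  have h3 : {v | v ∉ S ∨ v = i} = {v | v ∉ S.erase i} := by
    ext v
    simp only [Set.mem_ofPred_eq, Finset.mem_erase]
    tauto
  have h4 : (G.induce {v | v ∉ S ∨ v = i}).numComponents = G.numComponentsAfter (S.erase i) := by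
    rw [numComponentsAfter, h3]
  rw [IsCutPoint, numComponents_congr (induceInduceIso G hi), h4]
  exact lt_of_lt_of_le (not_le.mp h1) hS

end SimpleGraph

/-! ### Inclusions, heights and minimality of component primes -/

namespace MvPolynomial

variable {K : Type*} [Field K] {V W κ κ' : Type*}

/-- The second parametrization is a specialization of the first: columns are killed and blocks
merged. A block without surviving column may be sent to any value; `0` is chosen. -/
theorem ker_blockMap_le {c : W → Option κ} {c' : W → Option κ'}
    (h : ∀ j, c j = none → c' j = none)
    (h' : ∀ j l, c j = c l → c' j ≠ none → c' l ≠ none → c' j = c' l) :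
    RingHom.ker (blockMap K V c) ≤ RingHom.ker (blockMap K V c') := by
  classical
  let ψ : MvPolynomial ((V × κ) ⊕ W) K →ₐ[K] MvPolynomial ((V × κ') ⊕ W) K :=
    aeval (Sum.elim
      (fun q => if hq : ∃ k' j, c j = some q.2 ∧ c' j = some k' then
        X (.inl (q.1, hq.choose)) else 0)
      (fun j => if c' j = none then 0 else X (.inr j)))
  have hψ : ψ.comp (blockMap K V c) = blockMap K V c' := by
    ext ⟨i, j⟩ : 1
    rcases hc' : c' j with _ | k'
    · rcases hc : c j with _ | k
      · simp [blockMap_X_of_none hc, blockMap_X_of_none hc']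
      · simp [blockMap_X_of_some hc, blockMap_X_of_none hc', ψ, hc']
    · rcases hc : c j with _ | k
      · simp [h j hc] at hc'
      · have hq : ∃ k' j, c j = some k ∧ c' j = some k' := ⟨k', j, hc, hc'⟩
        have hk : hq.choose = k' := by
          obtain ⟨l, hl, hl'⟩ := hq.choose_spec
          have := h' j l (hc.trans hl.symm) (by simp [hc']) (by simp [hl'])
          rw [hc', hl'] at this
          exact (Option.some.inj this).symm
        simp only [AlgHom.comp_apply, blockMap_X_of_some hc, blockMap_X_of_some hc', ψ, map_mul,
          aeval_X, Sum.elim_inl, Sum.elim_inr, dif_pos hq, hk, hc', reduceCtorEq, if_false]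
  intro f hf
  rw [RingHom.mem_ker] at hf ⊢
  rw [← hψ, AlgHom.comp_apply, hf, map_zero]

end MvPolynomial

namespace SimpleGraph

open MvPolynomial

variable {K : Type*} [Field K] {V W : Type*}

theorem X_mem_componentPrime {G : SimpleGraph W} {T : Finset W} {i : V} {j : W} :
    X (i, j) ∈ componentPrime K V G T ↔ j ∈ T := by
  rw [componentPrime, RingHom.mem_ker]
  by_cases hj : j ∈ T
  · simp [hj, blockMap_X_of_none (componentAfter_eq_none.mpr hj)]
  · simp [hj, blockMap_X_of_some (componentAfter_of_notMem hj)]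

theorem minor_notMem_componentPrime {G : SimpleGraph W} {T : Finset W} {j l : W} (hj : j ∉ T)
    (hl : l ∉ T) (h : G.componentAfter T j ≠ G.componentAfter T l) {a b : V} (hab : a ≠ b) :
    X (a, j) * X (b, l) - X (a, l) * X (b, j) ∉ componentPrime K V G T := by
  classical
  rw [componentAfter_of_notMem hj, componentAfter_of_notMem hl] at h
  have h' : connectedComponentMk (G.induce {v | v ∉ T}) ⟨j, hj⟩ ≠ connectedComponentMk _ ⟨l, hl⟩ :=
    fun h' => h (congrArg some h')
  rw [componentPrime, RingHom.mem_ker, map_sub, map_mul, map_mul,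
    blockMap_X_of_some (componentAfter_of_notMem hj),
    blockMap_X_of_some (componentAfter_of_notMem hj),
    blockMap_X_of_some (componentAfter_of_notMem hl),
    blockMap_X_of_some (componentAfter_of_notMem hl)]
  intro h0
  -- At this point the two columns become distinct unit vectors, and the minor takes the value `1`.
  have := congrArg (eval (Sum.elim (fun q => if q = (a, connectedComponentMk _ ⟨j, hj⟩) ∨
    q = (b, connectedComponentMk _ ⟨l, hl⟩) then 1 else 0) (fun _ => 1) :
      (V × (G.induce {v | v ∉ T}).ConnectedComponent) ⊕ W → K)) h0
  simp [hab, h', hab.symm, -ConnectedComponent.eq] at this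

/-- If all neighbours of `i` outside `T` lie in one component, restoring `i` merges no components,
so the prime of `T` arises by also killing column `i`. -/
theorem componentPrime_erase_le [DecidableEq W] {G : SimpleGraph W} {T : Finset W} {i : W}
    (hi : i ∈ T) (h : ∀ a b, a ∉ T → b ∉ T → G.Adj i a → G.Adj i b →
      G.componentAfter T a = G.componentAfter T b) :
    componentPrime K V G (T.erase i) ≤ componentPrime K V G T := by
  have hle : ∀ v, v ∉ T → v ∉ T.erase i := fun v hv => mt Finset.mem_of_mem_erase hv
  have hle' : {v | v ∉ T.erase i} ⊆ {v | v ∉ T ∨ v = i} := fun v hv => by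
    simp only [Set.mem_ofPred_eq, Finset.mem_erase] at hv ⊢
    tauto
  refine ker_blockMap_le (fun j hj => ?_) (fun j l hjl hj hl => ?_)
  · rw [componentAfter_eq_none] at hj ⊢
    exact Finset.mem_of_mem_erase hj
  · rw [ne_eq, componentAfter_eq_none] at hj hl
    rw [componentAfter_eq_iff (hle _ hj) (hle _ hl)] at hjl
    exact componentAfter_eq_of_reachable hi h (x := ⟨j, Or.inl hj⟩) (y := ⟨l, Or.inl hl⟩) hj hl
      (hjl.map (induceHomOfLE G hle').toHom)

/-- The height of `componentPrime`. -/
theorem height_componentPrime [Fintype V] [Fintype W] [Nonempty V] (G : SimpleGraph W)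
    (T : Finset W) : ∃ h : ℕ, (componentPrime K V G T).height = h ∧
      (h : ℤ) = T.card +
        ((Fintype.card V : ℤ) - 1) * ((Fintype.card W : ℤ) - G.numComponentsAfter T) := by
  classical
  have := Fintype.ofFinite (G.induce {v | v ∉ T}).ConnectedComponent
  have h1 := G.numComponentsAfter_add_card_le T
  have h2 : G.numComponentsAfter T = Fintype.card (G.induce {v | v ∉ T}).ConnectedComponent :=
    Nat.card_eq_fintype_card
  have h3 : {j | G.componentAfter T j ≠ none}.toFinset.card = Tᶜ.card := by
    congr 1
    ext j
    simp [componentAfter_eq_none]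
  have h4 := Finset.card_compl_add_card T
  obtain ⟨m, hm⟩ : ∃ m, Fintype.card V = m + 1 :=
    Nat.exists_eq_succ_of_ne_zero Fintype.card_ne_zero
  obtain ⟨d, hd⟩ := Nat.exists_eq_add_of_le h1
  refine ⟨T.card + m * (T.card + d), height_ker_blockMap _ (fun k => ?_) ?_, ?_⟩
  · obtain ⟨⟨j, hj⟩, rfl⟩ := Quot.exists_rep k
    exact ⟨j, componentAfter_of_notMem hj⟩
  · rw [h3, ← h2, hm, Nat.add_sub_cancel, hd]
    have : Tᶜ.card = G.numComponentsAfter T + d := by omega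
    rw [this]
    ring
  · rw [hm, hd]
    push_cast
    ring

/-- The ratio of the entries of `y` and `z` agrees along edges, hence is constant on a connected
graph; the nonvanishing hypotheses make the ratios meaningful. -/
theorem rank_one_of_adj {F : Type*} [Field F] {G : SimpleGraph V}
    (hG : G.Preconnected) {y z : V → F} (hy : ∀ a, y a ≠ 0) (hz : ∀ a, z a ≠ 0)
    (h : ∀ a b, G.Adj a b → y a * z b = z a * y b) (a b : V) : y a * z b = z a * y b := by
  have hr := hG a b
  rw [reachable_iff_reflTransGen] at hr
  induction hr with
  | refl => ring
  | @tail b c _ hbc ih =>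
    have h1 := h b c hbc
    refine mul_right_cancel₀ (mul_ne_zero (hy b) (hz b)) ?_
    linear_combination y b * z c * ih + z a * y b * h1

theorem rank_one_trans {F : Type*} [Field F] {x y z : V → F} (hy : ∀ a, y a ≠ 0)
    (h1 : ∀ a b, x a * y b = y a * x b) (h2 : ∀ a b, y a * z b = z a * y b) (a b : V) :
    x a * z b = z a * x b := by
  refine mul_right_cancel₀ (mul_ne_zero (hy a) (hy b)) ?_
  linear_combination y a * z b * h1 a b + y a * x b * h2 a b

section Point

variable {F : Type*} [Field F] {G₁ : SimpleGraph V} {G : SimpleGraph W} {T : Finset W}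
  {y : W → V → F}

theorem rank_one_of_componentAfter_eq (hG₁ : G₁.Preconnected)
    (hy : ∀ a b j l, G₁.Adj a b → G.Adj j l → y j a * y l b = y l a * y j b)
    (hy0 : ∀ j ∉ T, ∀ a, y j a ≠ 0) {j l : W} (hj : j ∉ T) (hl : l ∉ T)
    (hjl : G.componentAfter T j = G.componentAfter T l) (a b : V) :
    y j a * y l b = y l a * y j b := by
  have hr := (componentAfter_eq_iff hj hl).mp hjl
  rw [reachable_iff_reflTransGen] at hr
  suffices H : ∀ x : {v | v ∉ T}, Relation.ReflTransGen (G.induce {v | v ∉ T}).Adj ⟨j, hj⟩ x →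
      ∀ a b, y j a * y x b = y x a * y j b from H _ hr a b
  intro x hx
  induction hx with
  | refl => exact fun a b => rfl
  | @tail k x _ hkx ih =>
    exact rank_one_trans (hy0 k k.2) ih (rank_one_of_adj hG₁ (hy0 k k.2) (hy0 x x.2)
      fun a b hab => hy a b k x hab hkx)

/-- A nonzero entry of column `j` would spread over the connected `G₁` to all its entries. Then `k`
and `l` would both be proportional to `j`, hence to each other. -/
theorem eq_zero_of_not_rank_one (hG₁ : G₁.Preconnected)
    (hy : ∀ a b j l, G₁.Adj a b → G.Adj j l → y j a * y l b = y l a * y j b)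
    {j k l : W} (hk : ∀ a, y k a ≠ 0) (hl : ∀ a, y l a ≠ 0) (hjk : G.Adj j k) (hjl : G.Adj j l)
    {a b : V} (hkl : y k a * y l b ≠ y l a * y k b) (i : V) : y j i = 0 := by
  by_contra hij
  have hall : ∀ a, y j a ≠ 0 := by
    intro a
    have hr := hG₁ i a
    rw [reachable_iff_reflTransGen] at hr
    induction hr with
    | refl => exact hij
    | @tail b c _ hbc ih =>
      intro h0
      have := hy b c j k hbc hjk
      rw [h0, mul_zero] at this
      exact mul_ne_zero ih (hk c) this
  exact hkl <| rank_one_trans hall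
    (rank_one_of_adj hG₁ hk hall fun a b hab => hy a b k j hab hjk.symm)
    (rank_one_of_adj hG₁ hall hl fun a b hab => hy a b j l hab hjl) a b

/-- A point satisfying the rank conditions factors through the parametrization `blockMap`. -/
theorem exists_comp_blockMap_eq [Nonempty V] [Algebra K F]
    (φ : MvPolynomial (V × W) K →ₐ[K] F) (hφ : ∀ j ∉ T, ∀ a, φ (X (a, j)) ≠ 0)
    (hφ0 : ∀ j ∈ T, ∀ a, φ (X (a, j)) = 0)
    (h : ∀ j l, j ∉ T → l ∉ T → G.componentAfter T j = G.componentAfter T l →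
      ∀ a b, φ (X (a, j)) * φ (X (b, l)) = φ (X (a, l)) * φ (X (b, j))) :
    ∃ ψ : MvPolynomial ((V × (G.induce {v | v ∉ T}).ConnectedComponent) ⊕ W) K →ₐ[K] F,
      ψ.comp (blockMap K V (G.componentAfter T)) = φ := by
  have i₀ : V := Classical.arbitrary V
  let rep (k : (G.induce {v | v ∉ T}).ConnectedComponent) : W := (Quot.out k).1
  have hrepT : ∀ k, rep k ∉ T := fun k => (Quot.out k).2
  have hrep : ∀ k, G.componentAfter T (rep k) = some k := fun k => by
    rw [componentAfter_of_notMem (hrepT k)]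
    exact congrArg some (Quot.out_eq k)
  refine ⟨aeval (Sum.elim (fun q => φ (X (q.1, rep q.2)) / φ (X (i₀, rep q.2)))
    (fun j => φ (X (i₀, j)))), ?_⟩
  ext ⟨i, j⟩ : 1
  rw [AlgHom.comp_apply]
  rcases hc : G.componentAfter T j with _ | k
  · rw [blockMap_X_of_none hc, map_zero, hφ0 j (componentAfter_eq_none.mp hc)]
  · have hj : j ∉ T := fun h => by
      rw [componentAfter_eq_none.mpr h] at hc
      cases hc
    rw [blockMap_X_of_some hc, map_mul, aeval_X, aeval_X, Sum.elim_inl, Sum.elim_inr,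
      div_mul_eq_mul_div, div_eq_iff (hφ _ (hrepT k) _)]
    exact h (rep k) j (hrepT k) hj ((hrep k).trans hc.symm) i i₀

end Point

/-- The prime ideals belonging to cut sets are minimal over the binomial edge ideal. -/
theorem componentPrime_mem_minimalPrimes [Finite W] [Nontrivial V] {G₁ : SimpleGraph V}
    (hG₁ : G₁.Connected) {G : SimpleGraph W} {T : Finset W} (hT : T ∈ G.cutPointSets) :
    componentPrime K V G T ∈ (pairBinomialEdgeIdeal K G₁ G).minimalPrimes := by
  rw [mem_cutPointSets_iff] at hT
  refine ⟨⟨inferInstance, pairBinomialEdgeIdeal_le_componentPrime G₁ G T⟩, ?_⟩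
  rintro Q ⟨hQ, hJQ⟩ hQT
  -- The generic point of `Q` is used: over this field membership in `Q` is vanishing, and the aim
  -- is to factor the point through the parametrization, so that `Q` contains its kernel.
  let F := FractionRing (MvPolynomial (V × W) K ⧸ Q)
  obtain ⟨φ, hφ⟩ : ∃ φ : MvPolynomial (V × W) K →ₐ[K] F, ∀ f, φ f = 0 ↔ f ∈ Q := by
    refine ⟨(IsScalarTower.toAlgHom K (MvPolynomial (V × W) K ⧸ Q) F).comp
      (Ideal.Quotient.mkₐ K Q), fun f => ?_⟩
    change algebraMap (MvPolynomial (V × W) K ⧸ Q) F (Ideal.Quotient.mk Q f) = 0 ↔ _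
    rw [map_eq_zero_iff _ (IsFractionRing.injective _ F), Ideal.Quotient.eq_zero_iff_mem]
  have hy0 : ∀ j ∉ T, ∀ i, φ (X (i, j)) ≠ 0 := fun j hj i h =>
    hj (X_mem_componentPrime.mp (hQT ((hφ _).mp h)))
  have hminor : ∀ a b j l, φ (X (a, j)) * φ (X (b, l)) = φ (X (a, l)) * φ (X (b, j)) ↔
      X (a, j) * X (b, l) - X (a, l) * X (b, j) ∈ Q := fun a b j l => by
    rw [← hφ, map_sub, map_mul, map_mul, sub_eq_zero]
  have hedge : ∀ a b j l, G₁.Adj a b → G.Adj j l →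
      φ (X (a, j)) * φ (X (b, l)) = φ (X (a, l)) * φ (X (b, j)) :=
    fun a b j l hab hjl => (hminor a b j l).mpr (hJQ
      (Ideal.subset_span ⟨a, b, j, l, hab, hjl, rfl⟩))
  have hzero : ∀ j ∈ T, ∀ i, φ (X (i, j)) = 0 := by
    intro j hj i
    obtain ⟨k, l, hk, hl, hjk, hjl, hkl⟩ := hT j hj
    obtain ⟨a, b, hab⟩ := exists_pair_ne V
    exact eq_zero_of_not_rank_one (y := fun j i => φ (X (i, j))) hG₁.preconnected hedge
      (hy0 k hk) (hy0 l hl) hjk hjl (a := a) (b := b) (fun h =>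
        minor_notMem_componentPrime (K := K) hk hl hkl hab (hQT ((hminor a b k l).mp h))) i
  obtain ⟨ψ, hψ⟩ := exists_comp_blockMap_eq φ hy0 hzero fun j l hj hl hjl =>
    rank_one_of_componentAfter_eq (y := fun j i => φ (X (i, j))) hG₁.preconnected hedge hy0 hj hl
      hjl
  intro f hf
  rw [← hφ, ← hψ, AlgHom.comp_apply, RingHom.mem_ker.mp hf, map_zero]

end SimpleGraph

/-! ### Unmixedness and the numerical condition on cut sets -/

theorem Ideal.IsUnmixed.height_eq {R : Type*} [CommRing R] [IsNoetherianRing R] {I : Ideal R}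
    (h : I.IsUnmixed) {p q : Ideal R} (hp : p ∈ I.minimalPrimes) (hq : q ∈ I.minimalPrimes) :
    p.height = q.height := by
  have hI := Module.associatedPrimes.minimalPrimes_annihilator_subset_associatedPrimes R (R ⧸ I)
  rw [Ideal.annihilator_quotient] at hI
  exact h p (hI hp) q (hI hq)

namespace SimpleGraph

open MvPolynomial

variable {K : Type*} [Field K] {V W : Type*}

/-- If the minimal primes have the same height, then all cut sets satisfy the numerical condition
that their prime ideals have the same height as the one of the empty set. -/
theorem card_eq_of_height_eq [Fintype V] [Nontrivial V] [Fintype W] {G₁ : SimpleGraph V}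
    {G : SimpleGraph W} (hG₁ : G₁.Connected) (hG : G.Connected)
    (h : ∀ p ∈ (pairBinomialEdgeIdeal K G₁ G).minimalPrimes,
      ∀ q ∈ (pairBinomialEdgeIdeal K G₁ G).minimalPrimes, p.height = q.height)
    {T : Finset W} (hT : T ∈ G.cutPointSets) :
    ((G.numComponentsAfter T : ℤ) - 1) * ((Fintype.card V : ℤ) - 1) = T.card := by
  have h1 := h _ (componentPrime_mem_minimalPrimes hG₁ hT) _
    (componentPrime_mem_minimalPrimes hG₁ G.empty_mem_cutPointSets)
  obtain ⟨a, ha, ha'⟩ := height_componentPrime (K := K) (V := V) G T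
  obtain ⟨b, hb, hb'⟩ := height_componentPrime (K := K) (V := V) G ∅
  rw [ha, hb, Nat.cast_inj] at h1
  rw [h1, hb', numComponentsAfter_empty, hG.numComponents_eq_one] at ha'
  rw [Finset.card_empty] at ha'
  push_cast at ha'
  linarith

/-- An associated prime is the annihilator of the class of some `f`, which is the intersection of
those component primes that do not contain `f`; being prime, it equals one of them. -/
theorem exists_eq_componentPrime_of_mem_associatedPrimes [Finite V] [Nonempty V] [Finite W]
    {G : SimpleGraph W} {p : Ideal (MvPolynomial (V × W) K)}
    (hp : p ∈ associatedPrimes _ (MvPolynomial (V × W) K ⧸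
      pairBinomialEdgeIdeal K (⊤ : SimpleGraph V) G)) :
    ∃ T ∈ G.cutPointSets, p = componentPrime K V G T := by
  classical
  have := Fintype.ofFinite W
  rw [AssociatedPrimes.mem_iff, isAssociatedPrime_iff] at hp
  obtain ⟨hp, x, hx⟩ := hp
  obtain ⟨f, rfl⟩ := Ideal.Quotient.mk_surjective x
  have hmem : ∀ r, r ∈ p ↔ ∀ T, r * f ∈ componentPrime K V G T := fun r => by
    have h1 : r ∈ p ↔ r * f ∈ pairBinomialEdgeIdeal K (⊤ : SimpleGraph V) G := by
      rw [hx, Submodule.mem_colon_singleton, Submodule.mem_bot, ← Ideal.Quotient.eq_zero_iff_mem,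
        map_mul]
      rfl
    rw [h1]
    exact ⟨fun h T => pairBinomialEdgeIdeal_le_componentPrime _ G T h,
      mem_pairBinomialEdgeIdeal_top G⟩
  have hle : ∀ T, f ∉ componentPrime K V G T → p ≤ componentPrime K V G T := fun T hT r hr =>
    (Ideal.IsPrime.mem_or_mem inferInstance ((hmem r).mp hr T)).resolve_right hT
  obtain ⟨T, hT, hTp⟩ : ∃ T, f ∉ componentPrime K V G T ∧ componentPrime K V G T ≤ p := by
    have : (Finset.univ.filter fun T => f ∉ componentPrime K V G T).inf
        (fun T => componentPrime K V G T) ≤ p := by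
      intro r hr
      rw [hmem]
      intro T
      by_cases hT : f ∈ componentPrime K V G T
      · exact Ideal.mul_mem_left _ _ hT
      · exact Ideal.mul_mem_right _ _ ((Finset.inf_le (by simpa using hT) :
          _ ≤ componentPrime K V G T) hr)
    obtain ⟨T, hT, hTp⟩ := (Ideal.IsPrime.inf_le' hp).mp this
    exact ⟨T, by simpa using hT, hTp⟩
  refine ⟨T, mem_cutPointSets_iff.mpr fun i hi => ?_, le_antisymm (hle T hT) hTp⟩
  -- If `i` fails the cut condition, the prime of `T.erase i` is contained in that of `T` and so
  -- also misses `f`. It therefore contains `p`, although it does not contain the variables of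
  -- column `i`.
  by_contra! hno
  have h1 := componentPrime_erase_le (K := K) (V := V) hi hno
  have h2 := hTp.trans (hle (T.erase i) fun h => hT (h1 h))
  have h3 := h2 (X_mem_componentPrime (i := Classical.arbitrary V) |>.mpr hi)
  rw [X_mem_componentPrime] at h3
  exact Finset.notMem_erase i T h3

theorem isUnmixed_pairBinomialEdgeIdeal_top [Fintype V] [Nonempty V] [Fintype W]
    {G : SimpleGraph W} (h : ∀ T ∈ G.cutPointSets,
      ((G.numComponentsAfter T : ℤ) - 1) * ((Fintype.card V : ℤ) - 1) = T.card) :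
    (pairBinomialEdgeIdeal K (⊤ : SimpleGraph V) G).IsUnmixed := by
  intro p hp q hq
  obtain ⟨S, hS, rfl⟩ := exists_eq_componentPrime_of_mem_associatedPrimes hp
  obtain ⟨T, hT, rfl⟩ := exists_eq_componentPrime_of_mem_associatedPrimes hq
  obtain ⟨a, ha, ha'⟩ := height_componentPrime (K := K) (V := V) G S
  obtain ⟨b, hb, hb'⟩ := height_componentPrime (K := K) (V := V) G T
  rw [ha, hb, Nat.cast_inj]
  have h1 := h S hS
  have h2 := h T hT
  zify
  rw [ha', hb', ← h1, ← h2]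
  ring

/-- The ideal of a complete and a connected graph is unmixed if and only if all cut sets satisfy
the numerical condition. -/
theorem isUnmixed_pairBinomialEdgeIdeal_top_iff [Fintype V] [Nontrivial V] [Fintype W]
    {G : SimpleGraph W} (hG : G.Connected) :
    (pairBinomialEdgeIdeal K (⊤ : SimpleGraph V) G).IsUnmixed ↔ ∀ T ∈ G.cutPointSets,
      ((G.numComponentsAfter T : ℤ) - 1) * ((Fintype.card V : ℤ) - 1) = T.card :=
  ⟨fun h _ hT => card_eq_of_height_eq connected_top hG (fun _ hp _ hq => h.height_eq hp hq) hT,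
    isUnmixed_pairBinomialEdgeIdeal_top⟩

theorem pairBinomialEdgeIdeal_le_comap_swap (G₁ : SimpleGraph V) (G : SimpleGraph W) :
    pairBinomialEdgeIdeal K G₁ G ≤ (pairBinomialEdgeIdeal K G G₁).comap
      (renameEquiv K (Equiv.prodComm V W)).toRingEquiv := by
  rw [pairBinomialEdgeIdeal, Ideal.span_le]
  rintro _ ⟨i, j, k, l, hij, hkl, rfl⟩
  refine Ideal.subset_span ⟨k, l, i, j, hkl, hij, ?_⟩
  simp [mul_comm]

theorem comap_swap_pairBinomialEdgeIdeal (G₁ : SimpleGraph V) (G : SimpleGraph W) :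
    (pairBinomialEdgeIdeal K G₁ G).comap
      (renameEquiv K (Equiv.prodComm W V)).toRingEquiv = pairBinomialEdgeIdeal K G G₁ := by
  refine le_antisymm (fun f hf => ?_) (pairBinomialEdgeIdeal_le_comap_swap G G₁)
  have h := pairBinomialEdgeIdeal_le_comap_swap G₁ G hf
  rw [Ideal.mem_comap] at h
  convert h
  exact ((renameEquiv K (Equiv.prodComm W V)).symm_apply_apply f).symm

/-- If the ideal of two connected graphs is unmixed and the first graph has at most as many
vertices as the second, then the first graph is complete. -/
theorem eq_top_of_isUnmixed [Fintype V] [Nontrivial V] [Fintype W] {G₁ : SimpleGraph V}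
    {G : SimpleGraph W} (hG₁ : G₁.Connected) (hG : G.Connected)
    (hcard : Fintype.card V ≤ Fintype.card W)
    (h : (pairBinomialEdgeIdeal K G₁ G).IsUnmixed) : G₁ = ⊤ := by
  by_contra hne
  obtain ⟨S, hS, hS2⟩ := exists_cutPointSet_of_ne_top hne
  have : Nontrivial W := Fintype.one_lt_card_iff_nontrivial.mp
    (lt_of_lt_of_le Fintype.one_lt_card hcard)
  have hswap : ∀ p ∈ (pairBinomialEdgeIdeal K G G₁).minimalPrimes,
      ∃ q ∈ (pairBinomialEdgeIdeal K G₁ G).minimalPrimes, p.height = q.height := by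
    intro p hp
    let e := (renameEquiv K (Equiv.prodComm W V)).toRingEquiv
    rw [← comap_swap_pairBinomialEdgeIdeal] at hp
    have hmin := Ideal.comap_minimalPrimes_eq_of_surjective (f := e.toRingHom) e.surjective
      (pairBinomialEdgeIdeal K G₁ G)
    obtain ⟨q, hq, rfl⟩ := hmin.subset hp
    exact ⟨q, hq, RingEquiv.height_comap e q⟩
  have h1 := card_eq_of_height_eq (K := K) hG hG₁ (fun p hp q hq => by
    obtain ⟨p', hp', hpp'⟩ := hswap p hp
    obtain ⟨q', hq', hqq'⟩ := hswap q hq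
    rw [hpp', hqq', h.height_eq hp' hq']) hS
  -- Since `c(S) ≥ 2`, this bounds `|S|` by `|V| - 2 < |W| - 1`, but `h1` makes `|S|` a positive
  -- multiple of `|W| - 1`.
  have h2 := G₁.numComponentsAfter_add_card_le S
  have h3 : 1 ≤ (G₁.numComponentsAfter S : ℤ) - 1 := by omega
  have h4 : (0 : ℤ) ≤ (Fintype.card W : ℤ) - 1 := by omega
  nlinarith


/-! ### Cut sets of disjoint unions and joins -/

theorem componentAfter_empty_eq {W : Type*} {G : SimpleGraph W} (hG : G.Preconnected) (a b : W) :
    G.componentAfter ∅ a = G.componentAfter ∅ b := by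
  rw [componentAfter_eq_iff (by simp) (by simp)]
  have hs : {v : W | v ∉ (∅ : Finset W)} = Set.univ := by ext; simp
  have h : (G.induce Set.univ).Preconnected := (induceUnivIso G).preconnected_iff.mpr hG
  rw [← hs] at h
  exact h _ _

theorem exists_notMem_of_mem_cutPointSets {W : Type*} [Finite W] [Nonempty W] {G : SimpleGraph W}
    {T : Finset W} (hT : T ∈ G.cutPointSets) : ∃ x, x ∉ T := by
  by_contra! h
  obtain ⟨a, -, ha, -⟩ := mem_cutPointSets_iff.mp hT (Classical.arbitrary W) (h _)
  exact ha (h a)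

section Sigma

variable {ι : Type*} {V : ι → Type*} {H : ∀ i, SimpleGraph (V i)}

theorem sigmaGraph_adj {x y : Σ i, V i} :
    (sigmaGraph H).Adj x y ↔ ∃ i a b, (H i).Adj a b ∧ ⟨i, a⟩ = x ∧ ⟨i, b⟩ = y := by
  simp [sigmaGraph, iSup_adj, map_adj]

theorem sigmaGraph_adj_mk {i : ι} {a b : V i} :
    (sigmaGraph H).Adj ⟨i, a⟩ ⟨i, b⟩ ↔ (H i).Adj a b := by
  rw [sigmaGraph_adj]
  constructor
  · rintro ⟨k, c, d, h, h1, h2⟩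
    cases h1
    cases h2
    exact h
  · exact fun h => ⟨i, a, b, h, rfl, rfl⟩

theorem sigmaGraph_reachable_iff {x y : Σ i, V i} :
    (sigmaGraph H).Reachable x y ↔
      (⟨x.1, (H x.1).connectedComponentMk x.2⟩ : Σ i, (H i).ConnectedComponent) =
        ⟨y.1, (H y.1).connectedComponentMk y.2⟩ := by
  constructor
  · intro h
    rw [reachable_iff_reflTransGen] at h
    induction h with
    | refl => rfl
    | tail _ hyz ih =>
      rw [ih]
      obtain ⟨i, a, b, hab, rfl, rfl⟩ := sigmaGraph_adj.mp hyz
      exact congrArg (Sigma.mk i) (ConnectedComponent.sound hab.reachable)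
  · obtain ⟨i, a⟩ := x
    obtain ⟨j, b⟩ := y
    intro h
    obtain ⟨rfl, h⟩ := Sigma.mk.inj h
    exact (ConnectedComponent.exact (eq_of_heq h)).map
      (⟨Sigma.mk i, fun h => sigmaGraph_adj_mk.mpr h⟩ : H i →g sigmaGraph H)

theorem numComponents_sigmaGraph [Fintype ι] [∀ i, Finite (V i)] :
    (sigmaGraph H).numComponents = ∑ i, (H i).numComponents := by
  have e : (sigmaGraph H).ConnectedComponent ≃ Σ i, (H i).ConnectedComponent :=
    Equiv.ofBijective (Quot.lift (fun x => ⟨x.1, (H x.1).connectedComponentMk x.2⟩)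
      fun _ _ h => sigmaGraph_reachable_iff.mp h) (by
      constructor
      · refine ConnectedComponent.ind₂ fun x y h => ?_
        exact ConnectedComponent.sound (sigmaGraph_reachable_iff.mpr h)
      · rintro ⟨i, c⟩
        induction c using ConnectedComponent.ind with
        | _ a => exact ⟨connectedComponentMk _ ⟨i, a⟩, rfl⟩)
  rw [numComponents, Nat.card_congr e, Nat.card_sigma]
  rfl

end Sigma

section Join

variable {U W : Type*} {G : SimpleGraph U} {G' : SimpleGraph W}

@[simp]
theorem joinGraph_adj_inl_inl {a b : U} : (G.joinGraph G').Adj (.inl a) (.inl b) ↔ G.Adj a b := by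
  simp [joinGraph]

@[simp]
theorem joinGraph_adj_inr_inr {a b : W} : (G.joinGraph G').Adj (.inr a) (.inr b) ↔ G'.Adj a b := by
  simp [joinGraph]

@[simp]
theorem joinGraph_adj_inl_inr {a : U} {b : W} : (G.joinGraph G').Adj (.inl a) (.inr b) := by
  simp [joinGraph]

@[simp]
theorem joinGraph_adj_inr_inl {a : U} {b : W} : (G.joinGraph G').Adj (.inr b) (.inl a) :=
  joinGraph_adj_inl_inr.symm

theorem joinGraph_componentAfter_eq {T : Finset (U ⊕ W)} {x : U} {y : W} (hx : .inl x ∉ T)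
    (hy : .inr y ∉ T) {z : U ⊕ W} (hz : z ∉ T) :
    (G.joinGraph G').componentAfter T z = (G.joinGraph G').componentAfter T (.inl x) := by
  have hadj : ∀ {u v} (hu : u ∉ T) (hv : v ∉ T), (G.joinGraph G').Adj u v →
      (G.joinGraph G').componentAfter T u = (G.joinGraph G').componentAfter T v :=
    fun hu hv h => (componentAfter_eq_iff hu hv).mpr (Adj.reachable h)
  rcases z with z | z
  · exact (hadj hz hy joinGraph_adj_inl_inr).trans (hadj hy hx joinGraph_adj_inr_inl)
  · exact hadj hz hx joinGraph_adj_inr_inl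

theorem joinGraph_connected [Nonempty U] [Nonempty W] : (G.joinGraph G').Connected := by
  have hadj : ∀ z, (G.joinGraph G').Reachable z (.inl (Classical.arbitrary U)) := by
    rintro (z | z)
    · exact (Adj.reachable (joinGraph_adj_inl_inr (b := Classical.arbitrary W))).trans
        (Adj.reachable joinGraph_adj_inr_inl)
    · exact Adj.reachable joinGraph_adj_inr_inl
  exact ⟨fun a b => (hadj a).trans (hadj b).symm⟩

/-- If a vertex survives on each side, the rest of the join is connected, and no deleted vertex can
separate anything. -/
theorem subset_of_mem_cutPointSets_joinGraph [Finite U] [Finite W] {T : Finset (U ⊕ W)}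
    (hT : T ∈ (G.joinGraph G').cutPointSets) (hne : T ≠ ∅) :
    (∀ u, .inl u ∈ T) ∨ ∀ w, .inr w ∈ T := by
  by_contra! h
  obtain ⟨⟨u, hu⟩, ⟨w, hw⟩⟩ := h
  obtain ⟨i, hi⟩ := Finset.nonempty_iff_ne_empty.mpr hne
  obtain ⟨a, b, ha, hb, -, -, hab⟩ := mem_cutPointSets_iff.mp hT i hi
  exact hab ((joinGraph_componentAfter_eq hu hw ha).trans
    (joinGraph_componentAfter_eq hu hw hb).symm)

variable [Fintype W]

/-- Deleting the second graph and some vertices of the first one from the join. -/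
def joinGraphInduceLeftIso (G : SimpleGraph U) (G' : SimpleGraph W) (T : Finset U) :
    G.induce {u | u ∉ T} ≃g
      (G.joinGraph G').induce {v | v ∉ T.disjSum (Finset.univ : Finset W)} where
  toFun x := ⟨.inl x.1, by simpa [-Subtype.coe_prop] using x.2⟩
  invFun
    | ⟨.inl u, h⟩ => ⟨u, by simpa using h⟩
    | ⟨.inr w, h⟩ => (h (by simp)).elim
  left_inv _ := rfl
  right_inv
    | ⟨.inl _, _⟩ => rfl
    | ⟨.inr w, h⟩ => (h (by simp)).elim
  map_rel_iff' {_ _} := joinGraph_adj_inl_inl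

theorem numComponentsAfter_disjSum_univ (T : Finset U) :
    (G.joinGraph G').numComponentsAfter (T.disjSum Finset.univ) = G.numComponentsAfter T :=
  (numComponents_congr (joinGraphInduceLeftIso G G' T)).symm

theorem componentAfter_disjSum_univ {T : Finset U} {a b : U} (ha : a ∉ T) (hb : b ∉ T) :
    (G.joinGraph G').componentAfter (T.disjSum Finset.univ) (.inl a) =
      (G.joinGraph G').componentAfter (T.disjSum Finset.univ) (.inl b) ↔
      G.componentAfter T a = G.componentAfter T b := by
  rw [componentAfter_eq_iff (by simpa using ha) (by simpa using hb), componentAfter_eq_iff ha hb]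
  exact (joinGraphInduceLeftIso G G' T).reachable_iff (u := ⟨a, ha⟩) (v := ⟨b, hb⟩)

/-- Each vertex of `G'` is adjacent to all of `G - T`, so it only requires `G - T` to be
disconnected. This fails for `T = ∅`, and holds as soon as some vertex of `T` satisfies the cut
condition. -/
theorem disjSum_univ_mem_cutPointSets_iff [Finite U] [Nonempty W] (hG : G.Preconnected)
    {T : Finset U} :
    T.disjSum Finset.univ ∈ (G.joinGraph G').cutPointSets ↔ T ∈ G.cutPointSets ∧ T ≠ ∅ := by
  have hmem : ∀ x : U ⊕ W, x ∉ T.disjSum (Finset.univ : Finset W) → ∃ u ∉ T, x = .inl u := by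
    rintro (u | w) h
    · exact ⟨u, by simpa using h, rfl⟩
    · simp at h
  simp only [mem_cutPointSets_iff]
  constructor
  · intro h
    constructor
    · intro i hi
      obtain ⟨x, y, hx, hy, hix, hiy, hxy⟩ := h (.inl i) (by simpa using hi)
      obtain ⟨a, ha, rfl⟩ := hmem x hx
      obtain ⟨b, hb, rfl⟩ := hmem y hy
      rw [ne_eq, componentAfter_disjSum_univ ha hb] at hxy
      exact ⟨a, b, ha, hb, by simpa using hix, by simpa using hiy, hxy⟩
    · rintro rfl
      obtain ⟨x, y, hx, hy, -, -, hxy⟩ := h (.inr (Classical.arbitrary W)) (by simp)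
      obtain ⟨a, ha, rfl⟩ := hmem x hx
      obtain ⟨b, hb, rfl⟩ := hmem y hy
      rw [ne_eq, componentAfter_disjSum_univ ha hb] at hxy
      exact hxy (componentAfter_empty_eq hG a b)
  · rintro ⟨h, hne⟩ (i | w) hi
    · obtain ⟨a, b, ha, hb, hia, hib, hab⟩ := h i (by simpa using hi)
      refine ⟨.inl a, .inl b, by simpa using ha, by simpa using hb, by simpa, by simpa, ?_⟩
      rwa [ne_eq, componentAfter_disjSum_univ ha hb]
    · obtain ⟨i, hi⟩ := Finset.nonempty_iff_ne_empty.mpr hne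
      obtain ⟨a, b, ha, hb, -, -, hab⟩ := h i hi
      refine ⟨.inl a, .inl b, by simpa using ha, by simpa using hb, by simp, by simp, ?_⟩
      rwa [ne_eq, componentAfter_disjSum_univ ha hb]

end Join

section JoinSigma

variable {U ι : Type*} {V : ι → Type*} [Fintype U] [Fintype ι]

/-- Deleting the first graph and some vertices of the others from the join of a graph with a
disjoint union. -/
def joinSigmaGraphInduceIso (G : SimpleGraph U) (H : ∀ i, SimpleGraph (V i))
    (F : ∀ i, Finset (V i)) :
    sigmaGraph (fun i => (H i).induce {v | v ∉ F i}) ≃g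
      (G.joinGraph (sigmaGraph H)).induce
        {v | v ∉ (Finset.univ : Finset U).disjSum (Finset.univ.sigma F)} where
  toFun x := ⟨.inr ⟨x.1, x.2.1⟩, by simpa [-Subtype.coe_prop] using x.2.2⟩
  invFun
    | ⟨.inl u, h⟩ => (h (by simp)).elim
    | ⟨.inr w, h⟩ => ⟨w.1, w.2, by simpa using h⟩
  left_inv _ := rfl
  right_inv
    | ⟨.inl u, h⟩ => (h (by simp)).elim
    | ⟨.inr w, h⟩ => rfl
  map_rel_iff' {x y} := by
    obtain ⟨i, a, ha⟩ := x
    obtain ⟨j, b, hb⟩ := y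
    change (G.joinGraph (sigmaGraph H)).Adj (.inr ⟨i, a⟩) (.inr ⟨j, b⟩) ↔ _
    rw [joinGraph_adj_inr_inr]
    by_cases hij : i = j
    · subst hij
      rw [sigmaGraph_adj_mk, sigmaGraph_adj_mk]
      rfl
    · rw [sigmaGraph_adj, sigmaGraph_adj]
      constructor
      · rintro ⟨k, c, d, -, h1, h2⟩
        exact (hij ((congrArg Sigma.fst h1).symm.trans (congrArg Sigma.fst h2))).elim
      · rintro ⟨k, c, d, -, h1, h2⟩
        exact (hij ((congrArg Sigma.fst h1).symm.trans (congrArg Sigma.fst h2))).elim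

variable {G : SimpleGraph U} {H : ∀ i, SimpleGraph (V i)} {F : ∀ i, Finset (V i)}

theorem numComponentsAfter_univ_disjSum [∀ i, Finite (V i)] :
    (G.joinGraph (sigmaGraph H)).numComponentsAfter (Finset.univ.disjSum (Finset.univ.sigma F)) =
      ∑ i, (H i).numComponentsAfter (F i) := by
  rw [numComponentsAfter, ← numComponents_congr (joinSigmaGraphInduceIso G H F),
    numComponents_sigmaGraph]
  rfl

theorem componentAfter_univ_disjSum {i j : ι} {a : V i} {b : V j} (ha : a ∉ F i) (hb : b ∉ F j) :
    (G.joinGraph (sigmaGraph H)).componentAfter (Finset.univ.disjSum (Finset.univ.sigma F))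
        (.inr ⟨i, a⟩) =
      (G.joinGraph (sigmaGraph H)).componentAfter (Finset.univ.disjSum (Finset.univ.sigma F))
        (.inr ⟨j, b⟩) ↔
      (⟨i, connectedComponentMk _ ⟨a, ha⟩⟩ :
        Σ i, ((H i).induce {v | v ∉ F i}).ConnectedComponent) =
        ⟨j, connectedComponentMk _ ⟨b, hb⟩⟩ := by
  rw [componentAfter_eq_iff (by simpa using ha) (by simpa using hb)]
  exact ((joinSigmaGraphInduceIso G H F).reachable_iff
    (u := ⟨i, ⟨a, ha⟩⟩) (v := ⟨j, ⟨b, hb⟩⟩)).trans sigmaGraph_reachable_iff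

theorem componentAfter_univ_disjSum_same {i : ι} {a b : V i} (ha : a ∉ F i) (hb : b ∉ F i) :
    (G.joinGraph (sigmaGraph H)).componentAfter (Finset.univ.disjSum (Finset.univ.sigma F))
        (.inr ⟨i, a⟩) =
      (G.joinGraph (sigmaGraph H)).componentAfter (Finset.univ.disjSum (Finset.univ.sigma F))
        (.inr ⟨i, b⟩) ↔ (H i).componentAfter (F i) a = (H i).componentAfter (F i) b := by
  rw [componentAfter_univ_disjSum ha hb, componentAfter_of_notMem ha, componentAfter_of_notMem hb]
  constructor
  · intro h
    exact congrArg some (eq_of_heq (Sigma.mk.inj h).2)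
  · intro h
    rw [Option.some.inj h]

/-- The vertices of `G` impose no condition: they see the nonempty remainders of at least two
different `H i`, which are never connected to each other. -/
theorem univ_disjSum_mem_cutPointSets_iff [∀ i, Finite (V i)] [∀ i, Nonempty (V i)]
    [Nontrivial ι] :
    Finset.univ.disjSum (Finset.univ.sigma F) ∈ (G.joinGraph (sigmaGraph H)).cutPointSets ↔
      ∀ i, F i ∈ (H i).cutPointSets := by
  constructor
  · intro h i
    rw [mem_cutPointSets_iff] at h ⊢
    intro v hv
    have hmem : ∀ x : U ⊕ Σ i, V i, x ∉ Finset.univ.disjSum (Finset.univ.sigma F) →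
        (G.joinGraph (sigmaGraph H)).Adj (.inr ⟨i, v⟩) x →
        ∃ a ∉ F i, x = .inr ⟨i, a⟩ ∧ (H i).Adj v a := by
      rintro (u | w) hx hadj
      · simp at hx
      · obtain ⟨j, a, b, hab, h1, rfl⟩ := sigmaGraph_adj.mp (joinGraph_adj_inr_inr.mp hadj)
        cases h1
        exact ⟨b, by simpa using hx, rfl, hab⟩
    obtain ⟨x, y, hx, hy, hvx, hvy, hxy⟩ := h (.inr ⟨i, v⟩) (by simpa using hv)
    obtain ⟨a, ha, rfl, hva⟩ := hmem x hx hvx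
    obtain ⟨b, hb, rfl, hvb⟩ := hmem y hy hvy
    rw [ne_eq, componentAfter_univ_disjSum_same ha hb] at hxy
    exact ⟨a, b, ha, hb, hva, hvb, hxy⟩
  · intro h
    rw [mem_cutPointSets_iff]
    rintro (u | ⟨i, v⟩) hx
    · obtain ⟨i, j, hij⟩ := exists_pair_ne ι
      obtain ⟨a, ha⟩ := exists_notMem_of_mem_cutPointSets (h i)
      obtain ⟨b, hb⟩ := exists_notMem_of_mem_cutPointSets (h j)
      refine ⟨.inr ⟨i, a⟩, .inr ⟨j, b⟩, by simpa using ha, by simpa using hb, by simp, by simp, ?_⟩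
      rw [ne_eq, componentAfter_univ_disjSum ha hb]
      exact fun h => hij (congrArg Sigma.fst h)
    · obtain ⟨a, b, ha, hb, hva, hvb, hab⟩ :=
        mem_cutPointSets_iff.mp (h i) v (by simpa using hx)
      refine ⟨.inr ⟨i, a⟩, .inr ⟨i, b⟩, by simpa using ha, by simpa using hb,
        by simpa [sigmaGraph_adj_mk], by simpa [sigmaGraph_adj_mk], ?_⟩
      rwa [ne_eq, componentAfter_univ_disjSum_same ha hb]

/-- The cut sets of the join of a connected graph with a disjoint union of at least two connected
graphs. -/
theorem mem_cutPointSets_joinGraph_sigmaGraph [∀ i, Fintype (V i)] [∀ i, Nonempty (V i)]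
    [Nontrivial ι] (hG : G.Preconnected) {T : Finset (U ⊕ Σ i, V i)} :
    T ∈ (G.joinGraph (sigmaGraph H)).cutPointSets ↔ T = ∅ ∨
      (∃ F : ∀ i, Finset (V i), (∀ i, F i ∈ (H i).cutPointSets) ∧
        T = Finset.univ.disjSum (Finset.univ.sigma F)) ∨
      ∃ S ∈ G.cutPointSets, S ≠ ∅ ∧ T = S.disjSum Finset.univ := by
  classical
  have : Nonempty (Σ i, V i) := ⟨⟨Classical.arbitrary ι, Classical.arbitrary _⟩⟩
  constructor
  · intro hT
    refine or_iff_not_imp_left.mpr fun hne => ?_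
    rcases subset_of_mem_cutPointSets_joinGraph hT hne with h | h
    · obtain ⟨F, rfl⟩ : ∃ F : ∀ i, Finset (V i), T = Finset.univ.disjSum (Finset.univ.sigma F) :=
        ⟨fun i => Finset.univ.filter fun a => .inr ⟨i, a⟩ ∈ T, by ext (u | w) <;> simp [h]⟩
      exact Or.inl ⟨_, univ_disjSum_mem_cutPointSets_iff.mp hT, rfl⟩
    · obtain ⟨S, rfl⟩ : ∃ S : Finset U, T = S.disjSum Finset.univ :=
        ⟨Finset.univ.filter fun u => .inl u ∈ T, by ext (u | w) <;> simp [h]⟩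
      obtain ⟨h1, h2⟩ := (disjSum_univ_mem_cutPointSets_iff hG).mp hT
      exact Or.inr ⟨S, h1, h2, rfl⟩
  · rintro (rfl | ⟨F, hF, rfl⟩ | ⟨S, hS, hne, rfl⟩)
    · exact empty_mem_cutPointSets _
    · exact univ_disjSum_mem_cutPointSets_iff.mpr hF
    · exact (disjSum_univ_mem_cutPointSets_iff hG).mpr ⟨hS, hne⟩

/-- The numerical condition on the cut sets of a join in terms of the single graphs. -/
theorem forall_cutPointSets_joinGraph_sigmaGraph_iff [∀ i, Fintype (V i)] [Nonempty U]
    [Nontrivial ι] (hG : G.Connected) (hH : ∀ i, (H i).Connected) (m : ℤ) :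
    (∀ T ∈ (G.joinGraph (sigmaGraph H)).cutPointSets,
      (((G.joinGraph (sigmaGraph H)).numComponentsAfter T : ℤ) - 1) * m = T.card) ↔
    (∀ i, ∀ T ∈ (H i).cutPointSets, (((H i).numComponentsAfter T : ℤ) - 1) * m = T.card) ∧
      (Fintype.card U : ℤ) = ((Fintype.card ι : ℤ) - 1) * m ∧
      ∀ S ∈ G.cutPointSets, S ≠ ∅ →
        ((G.numComponentsAfter S : ℤ) - 1) * m = S.card + ∑ i, (Fintype.card (V i) : ℤ) := by
  classical
  have hne : ∀ i, Nonempty (V i) := fun i => (hH i).nonempty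
  have : Nonempty (Σ i, V i) := ⟨⟨Classical.arbitrary ι, Classical.arbitrary _⟩⟩
  have hone : ∀ i, (H i).numComponentsAfter ∅ = 1 := fun i => by
    rw [numComponentsAfter_empty, (hH i).numComponents_eq_one]
  -- Writing `∑ cᵢ - 1` as `∑ (cᵢ - 1) + (r - 1)`, with `r` the number of graphs `H i`, separates
  -- the conditions on the single `H i` from the one on the size of `U`.
  have hcut : ∀ F : ∀ i, Finset (V i),
      (((G.joinGraph (sigmaGraph H)).numComponentsAfter
        (Finset.univ.disjSum (Finset.univ.sigma F)) : ℤ) - 1) * m =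
          ((Finset.univ.disjSum (Finset.univ.sigma F) : Finset (U ⊕ Σ i, V i)).card : ℤ) ↔
      ∑ i, (((H i).numComponentsAfter (F i) : ℤ) - 1) * m + ((Fintype.card ι : ℤ) - 1) * m =
        Fintype.card U + ∑ i, ((F i).card : ℤ) := by
    intro F
    rw [numComponentsAfter_univ_disjSum, Finset.card_disjSum, Finset.card_univ, Finset.card_sigma,
      ← Finset.sum_mul, Finset.sum_sub_distrib]
    push_cast
    rw [Finset.sum_const, Finset.card_univ, nsmul_one, ← add_mul]
    ring_nf
  constructor
  · intro h
    have hF : ∀ F : ∀ i, Finset (V i), (∀ i, F i ∈ (H i).cutPointSets) →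
        ∑ i, (((H i).numComponentsAfter (F i) : ℤ) - 1) * m + ((Fintype.card ι : ℤ) - 1) * m =
          Fintype.card U + ∑ i, ((F i).card : ℤ) := fun F hF =>
      (hcut F).mp (h _ (univ_disjSum_mem_cutPointSets_iff.mpr hF))
    have hU : (Fintype.card U : ℤ) = ((Fintype.card ι : ℤ) - 1) * m := by
      simpa [hone] using (hF (fun _ => ∅) fun i => empty_mem_cutPointSets _).symm
    refine ⟨fun i T hT => ?_, hU, fun S hS hne => ?_⟩
    · have h1 := hF (Function.update (fun _ => ∅) i T) (fun j => by
        by_cases hj : j = i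
        · subst hj
          simpa using hT
        · simpa [hj] using empty_mem_cutPointSets _)
      rw [Finset.sum_eq_single i (fun j _ hj => by simp [hj, hone]) (by simp),
        Finset.sum_eq_single i (fun j _ hj => by simp [hj]) (by simp), hU] at h1
      simp only [Function.update_self] at h1
      linarith
    · have h1 := h _ ((disjSum_univ_mem_cutPointSets_iff hG.preconnected).mpr ⟨hS, hne⟩)
      rw [numComponentsAfter_disjSum_univ, Finset.card_disjSum, Finset.card_univ,
        Fintype.card_sigma] at h1
      exact_mod_cast h1
  · rintro ⟨ha, hc, hd⟩ T hT
    rcases (mem_cutPointSets_joinGraph_sigmaGraph hG.preconnected).mp hT with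
      rfl | ⟨F, hF, rfl⟩ | ⟨S, hS, hne, rfl⟩
    · rw [numComponentsAfter_empty, joinGraph_connected.numComponents_eq_one]
      simp
    · rw [hcut, Finset.sum_congr rfl fun i _ => ha i (F i) (hF i), hc]
      ring
    · rw [numComponentsAfter_disjSum_univ, hd S hS hne, Finset.card_disjSum, Finset.card_univ,
        Fintype.card_sigma]
      push_cast
      rfl

end JoinSigma

end SimpleGraph

/-! ### The main theorem -/

theorem theorem4p6 (K : Type*) [Field K] {m t r : ℕ} {n : Fin r → ℕ}
    (G₁ : SimpleGraph (Fin m)) (H : SimpleGraph (Fin t))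
    (Hs : ∀ i : Fin r, SimpleGraph (Fin (n i)))
    (hG₁ : G₁.Connected) (hH : H.Connected) (hHs : ∀ i, (Hs i).Connected)
    (hr : 2 ≤ r) (hm : 2 ≤ m) (hmn : m ≤ t + ∑ i, n i)
    (hn : ∀ i, n i = 1 ∨ m ≤ n i) :
    (SimpleGraph.pairBinomialEdgeIdeal K G₁ (H.joinGraph (SimpleGraph.sigmaGraph Hs))).IsUnmixed ↔
      (∀ i, (SimpleGraph.pairBinomialEdgeIdeal K G₁ (Hs i)).IsUnmixed) ∧
      G₁ = ⊤ ∧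
      (t : ℤ) = ((r : ℤ) - 1) * ((m : ℤ) - 1) ∧
      (∀ T ∈ H.cutPointSets, T ≠ ∅ →
        ((H.numComponentsAfter T : ℤ) - 1) * ((m : ℤ) - 1) = (T.card : ℤ) + ∑ i, (n i : ℤ)) := by
  have : Nontrivial (Fin m) := Fin.nontrivial_iff_two_le.mpr hm
  have : Nontrivial (Fin r) := Fin.nontrivial_iff_two_le.mpr hr
  have : Nonempty (Fin t) := hH.nonempty
  have : Nonempty (Σ i, Fin (n i)) := ⟨⟨⟨0, by omega⟩, (hHs _).nonempty.some⟩⟩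
  have hG : (H.joinGraph (SimpleGraph.sigmaGraph Hs)).Connected := SimpleGraph.joinGraph_connected
  have key : (SimpleGraph.pairBinomialEdgeIdeal K (⊤ : SimpleGraph (Fin m))
      (H.joinGraph (SimpleGraph.sigmaGraph Hs))).IsUnmixed ↔
      (∀ i, (SimpleGraph.pairBinomialEdgeIdeal K (⊤ : SimpleGraph (Fin m)) (Hs i)).IsUnmixed) ∧
      (t : ℤ) = ((r : ℤ) - 1) * ((m : ℤ) - 1) ∧
      (∀ T ∈ H.cutPointSets, T ≠ ∅ →
        ((H.numComponentsAfter T : ℤ) - 1) * ((m : ℤ) - 1) =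
          (T.card : ℤ) + ∑ i, (n i : ℤ)) := by
    rw [SimpleGraph.isUnmixed_pairBinomialEdgeIdeal_top_iff hG,
      forall_congr' fun i => SimpleGraph.isUnmixed_pairBinomialEdgeIdeal_top_iff (hHs i),
      SimpleGraph.forall_cutPointSets_joinGraph_sigmaGraph_iff hH hHs]
    simp only [Fintype.card_fin]
  constructor
  · intro h
    obtain rfl := SimpleGraph.eq_top_of_isUnmixed hG₁ hG (by simpa using hmn) h
    obtain ⟨h1, h2⟩ := key.mp h
    exact ⟨h1, rfl, h2⟩
  · rintro ⟨h1, rfl, h2⟩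
    exact key.mpr ⟨h1, h2⟩
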